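/- Let $n \ge 1$, let $A \in \mathbb{Z}^{n\times n}$ with $\Delta = |\det A| > 0$, let $b \in \mathbb{Z}^n$, and let $\mathcal{P} = \{x \in \mathbb{R}^n : Ax \le b\}$. Let $h_1,\dots,h_n$ be the columns of the integer matrix $A^* = \Delta \cdot A^{-1}$, let $c \in \mathbb{Z}^n$ satisfy $\langle c, h_i\rangle > 0$ for all $i$, and put $\chi = \max_i |\langle c, h_i\rangle|$. Let $S = PAQ$ be the Smith normal form (SNF) of $A$, with $P, Q \in \mathbb{Z}^{n\times n}$ unimodular (thus $S$ is diagonal with nonnegative diagonal entries, each of which divides the next), and put $\sigma = S_{nn}$. (1) There are $\epsilon_i \in \mathbb{Z}_{\ge 0}$ and $\alpha_i \in \mathbb{Z}$ for $-n\sigma\chi \le i \le n\sigma\chi$, and $\beta_1,\dots,\beta_n \in \mathbb{Z}_{<0}$, such that for every $\tau > 0$ the series $\sum_{z \in \mathcal{P}\cap\mathbb{Z}^n} e^{\langle c, z\rangle \tau}$ converges absolutely and $$ \sum_{z \in \mathcal{P}\cap\mathbb{Z}^n} e^{\langle c, z\rangle \tau} \;=\; \frac{\sum_{i=-n\sigma\chi}^{n\sigma\chi}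 \epsilon_i\, e^{\alpha_i \tau}}{(1-e^{\beta_1\tau})(1-e^{\beta_2\tau})\cdots(1-e^{\beta_n\tau})}. $$ (2) Such a representation (the number $n\sigma\chi$ and all $\epsilon_i, \alpha_i, \beta_j$) can be computed from $n, A, b, c$ with $$ O\bigl(T_{\mathrm{SNF}} + \Delta\cdot n^2\cdot\sigma\cdot\chi\bigr) $$ arithmetic operations, where $T_{\mathrm{SNF}}$ is the arithmetic complexity of computing the SNF. Precisely: consider random access machines over $\mathbb{Z}$ on which $+$, $-$, $\cdot$, division with remainder, comparison, memory access and branching, and possibly the members of some further fixed family of operations on $\mathbb{Z}$ (such as extended gcd), have unit cost. There is an absolute constant $K$ such that for every such family and every program that computes $S, P, Q$ for every nonsingular integer matrix $A$ of every size $n \ge 1$ in at most $T_{\mathrm{SNF}}(n, A)$ steps, there is one program, with the same available operations, that for all $n, A, b, c$ as above outputs a representation as in (1) after at most $K\,(T_{\mathrm{SNF}}(n, A) + \Delta n^2\sigma\chi)$ steps. -/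

import Mathlib

namespace ConeSeries

/-! ### Polyhedra, exponential series and the matrix `Δ · A⁻¹` -/

/-- The polyhedron `{x ∈ ℝⁿ : A x ≤ b}`. -/
def polyhedron {n : ℕ} (A : Matrix (Fin n) (Fin n) ℤ) (b : Fin n → ℤ) : Set (Fin n → ℝ) :=
  {x | ∀ i, (A.map (Int.cast : ℤ → ℝ)).mulVec x i ≤ (b i : ℝ)}

/-- The integer points of a subset of `ℝⁿ`. -/
def integerPoints {n : ℕ} (X : Set (Fin n → ℝ)) : Set (Fin n → ℤ) :=
  {z | (fun i => (z i : ℝ)) ∈ X}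

/-- The integer matrix `A^* = Δ · A⁻¹`, `Δ = |det A|`, written without division; see
`starMatrix_eq`. -/
def starMatrix {n : ℕ} (A : Matrix (Fin n) (Fin n) ℤ) : Matrix (Fin n) (Fin n) ℤ :=
  A.det.sign • A.adjugate

theorem starMatrix_eq {n : ℕ} (A : Matrix (Fin n) (Fin n) ℤ) (hA : A.det ≠ 0) :
    (starMatrix A).map (Int.cast : ℤ → ℝ) =
      (A.det.natAbs : ℝ) • (A.map (Int.cast : ℤ → ℝ))⁻¹ := by
  have hdet : (A.map (Int.cast : ℤ → ℝ)).det = (A.det : ℝ) :=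
    ((Int.castRingHom ℝ).map_det A).symm
  have hadj : (A.map (Int.cast : ℤ → ℝ)).adjugate = A.adjugate.map (Int.cast : ℤ → ℝ) :=
    ((Int.castRingHom ℝ).map_adjugate A).symm
  have h0 : (A.det : ℝ) ≠ 0 := by exact_mod_cast hA
  have hs : (A.det.natAbs : ℝ) = (A.det.sign : ℝ) * (A.det : ℝ) := by
    have h : A.det.sign * A.det = (A.det.natAbs : ℤ) := Int.sign_mul_self_eq_natAbs A.det
    rw [← Int.cast_mul, h, Int.cast_natCast]
  rw [Matrix.inv_def, hdet, hadj, Ring.inverse_eq_inv', smul_smul, hs, mul_assoc,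
    mul_inv_cancel₀ h0, mul_one]
  ext i j
  simp only [starMatrix, Matrix.map_apply, Matrix.smul_apply, smul_eq_mul, Int.cast_mul]

/-- `χ = max_i |⟨c, h_i⟩|`, where `h_i` are the columns of `A^*`. -/
def chi {n : ℕ} (A : Matrix (Fin n) (Fin n) ℤ) (c : Fin n → ℤ) : ℕ :=
  Finset.univ.sup fun i => (c ⬝ᵥ (starMatrix A).col i).natAbs

/-- `S = P A Q` is the Smith normal form of `A`, with unimodular `P` and `Q`. -/
structure IsSNF {n : ℕ} (A S P Q : Matrix (Fin n) (Fin n) ℤ) : Prop where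
  eq_mul : S = P * A * Q
  unimodular_left : IsUnit P.det
  unimodular_right : IsUnit Q.det
  off_diag : ∀ i j, i ≠ j → S i j = 0
  nonneg : ∀ i, 0 ≤ S i i
  dvd : ∀ i j, i ≤ j → S i i ∣ S j j

/-- For every `τ > 0` the series `∑ e^{⟨c,z⟩τ}` over the integer points `z` of `{A x ≤ b}`
converges absolutely to
`(∑_{i=-N}^{N} ε_i e^{α_i τ}) / ((1 - e^{β_1 τ}) ⋯ (1 - e^{β_n τ}))`, where all `β_j < 0`. -/
structure IsRepresentation {n : ℕ} (A : Matrix (Fin n) (Fin n) ℤ) (b c : Fin n → ℤ) (N : ℕ)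
    (ε : ℤ → ℕ) (α : ℤ → ℤ) (β : Fin n → ℤ) : Prop where
  beta_neg : ∀ j, β j < 0
  abs_summable : ∀ τ : ℝ, 0 < τ →
    Summable fun z : integerPoints (polyhedron A b) =>
      |Real.exp (((c ⬝ᵥ (z : Fin n → ℤ) : ℤ) : ℝ) * τ)|
  hasSum : ∀ τ : ℝ, 0 < τ →
    HasSum (fun z : integerPoints (polyhedron A b) =>
        Real.exp (((c ⬝ᵥ (z : Fin n → ℤ) : ℤ) : ℝ) * τ))
      ((∑ i ∈ Finset.Icc (-(N : ℤ)) (N : ℤ), (ε i : ℝ) * Real.exp ((α i : ℝ) * τ)) /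
        ∏ j, (1 - Real.exp ((β j : ℝ) * τ)))

/-! ### Arithmetic random access machines

Programs act on integer registers `0, 1, 2, …` and on integer arrays `0, 1, 2, …`, and may use
computed addresses.  Every operation, memory access and branching has unit cost.  Besides
`+, -, *`, division with remainder and comparison, a program may use a family `F` of
additional unit-cost operations, indexed by `ι` (for the plain machine `ι` is empty; other
choices are, for example, extended-gcd operations). -/

/-- The memory of the machine. -/
structure State where
  reg : ℕ → ℤ
  arr : ℕ → ℤ → ℤ

/-- The basic operations; `div` and `mod` are division with remainder (with value `0`,
respectively the dividend, if the divisor is `0`), and `le` has value `1` if the comparison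
holds and `0` otherwise. -/
inductive BinOp
  | add | sub | mul | div | mod | le

/-- The value of a basic operation. -/
def BinOp.eval : BinOp → ℤ → ℤ → ℤ
  | .add, x, y => x + y
  | .sub, x, y => x - y
  | .mul, x, y => x * y
  | .div, x, y => x / y
  | .mod, x, y => x % y
  | .le, x, y => if x ≤ y then 1 else 0

/-- Expressions: constants, registers, array entries and operations. -/
inductive Expr (ι : Type)
  | const (k : ℤ)
  | reg (x : ℕ)
  | arr (a : ℕ) (i : Expr ι)
  | op (o : BinOp) (e₁ e₂ : Expr ι)
  | ext (f : ι) (e₁ e₂ e₃ : Expr ι)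

/-- The value of an expression. -/
def Expr.eval {ι : Type} (F : ι → ℤ → ℤ → ℤ → ℤ) (s : State) : Expr ι → ℤ
  | .const k => k
  | .reg x => s.reg x
  | .arr a i => s.arr a (i.eval F s)
  | .op o e₁ e₂ => o.eval (e₁.eval F s) (e₂.eval F s)
  | .ext f e₁ e₂ e₃ => F f (e₁.eval F s) (e₂.eval F s) (e₃.eval F s)

/-- The cost of evaluating an expression: one unit per constant, memory access or operation. -/
def Expr.cost {ι : Type} : Expr ι → ℕ
  | .const _ => 1
  | .reg _ => 1
  | .arr _ i => i.cost + 1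
  | .op _ e₁ e₂ => e₁.cost + e₂.cost + 1
  | .ext _ e₁ e₂ e₃ => e₁.cost + e₂.cost + e₃.cost + 1

/-- Programs; a condition holds if its value is nonzero. -/
inductive Prog (ι : Type)
  | skip
  | assign (x : ℕ) (e : Expr ι)
  | store (a : ℕ) (i e : Expr ι)
  | seq (p q : Prog ι)
  | ite (e : Expr ι) (p q : Prog ι)
  | loop (e : Expr ι) (p : Prog ι)

/-- The result of writing the value `v` into the register `x`. -/
def State.setReg (s : State) (x : ℕ) (v : ℤ) : State :=
  { s with reg := Function.update s.reg x v }

/-- The result of writing the value `v` into the entry `i` of the array `a`. -/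
def State.setArr (s : State) (a : ℕ) (i v : ℤ) : State :=
  { s with arr := Function.update s.arr a (Function.update (s.arr a) i v) }

/-- `Exec F p s t s'`: the program `p`, started in the memory `s`, halts after `t` steps
with the memory `s'`. -/
inductive Exec {ι : Type} (F : ι → ℤ → ℤ → ℤ → ℤ) : Prog ι → State → ℕ → State → Prop
  | skip (s : State) : Exec F .skip s 1 s
  | assign (x : ℕ) (e : Expr ι) (s : State) :
      Exec F (.assign x e) s (e.cost + 1) (s.setReg x (e.eval F s))
  | store (a : ℕ) (i e : Expr ι) (s : State) :
      Exec F (.store a i e) s (i.cost + e.cost + 1) (s.setArr a (i.eval F s) (e.eval F s))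
  | seq {p q : Prog ι} {s₀ s₁ s₂ : State} {t₁ t₂ : ℕ} :
      Exec F p s₀ t₁ s₁ → Exec F q s₁ t₂ s₂ → Exec F (.seq p q) s₀ (t₁ + t₂) s₂
  | ite_true {e : Expr ι} {p q : Prog ι} {s s' : State} {t : ℕ} :
      e.eval F s ≠ 0 → Exec F p s t s' → Exec F (.ite e p q) s (e.cost + 1 + t) s'
  | ite_false {e : Expr ι} {p q : Prog ι} {s s' : State} {t : ℕ} :
      e.eval F s = 0 → Exec F q s t s' → Exec F (.ite e p q) s (e.cost + 1 + t) s'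
  | loop_true {e : Expr ι} {p : Prog ι} {s₀ s₁ s₂ : State} {t₁ t₂ : ℕ} :
      e.eval F s₀ ≠ 0 → Exec F p s₀ t₁ s₁ → Exec F (.loop e p) s₁ t₂ s₂ →
      Exec F (.loop e p) s₀ (e.cost + 1 + t₁ + t₂) s₂
  | loop_false {e : Expr ι} {p : Prog ι} {s : State} :
      e.eval F s = 0 → Exec F (.loop e p) s (e.cost + 1) s

/-! ### Input and output -/

/-- The array with entries `v_0, …, v_{n-1}`, and `0` elsewhere. -/
def encodeVector {n : ℕ} (v : Fin n → ℤ) : ℤ → ℤ :=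
  fun k => ∑ i : Fin n, if k = (i : ℤ) then v i else 0

/-- The array with the entry `A_{ij}` at position `i n + j`, for `0 ≤ i, j < n`, and `0`
elsewhere. -/
def encodeMatrix {n : ℕ} (A : Matrix (Fin n) (Fin n) ℤ) : ℤ → ℤ :=
  fun k => ∑ i : Fin n, ∑ j : Fin n, if k = (i : ℤ) * n + j then A i j else 0

/-- Register `0` holds `n`, array `0` holds `A`; the rest of the memory is `0`. -/
def matrixInput {n : ℕ} (A : Matrix (Fin n) (Fin n) ℤ) : State where
  reg := fun x => if x = 0 then (n : ℤ) else 0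
  arr := fun a => if a = 0 then encodeMatrix A else 0

/-- Register `0` holds `n`, arrays `0, 1, 2` hold `A, b, c`; the rest of the memory is `0`. -/
def systemInput {n : ℕ} (A : Matrix (Fin n) (Fin n) ℤ) (b c : Fin n → ℤ) : State where
  reg := fun x => if x = 0 then (n : ℤ) else 0
  arr := fun a =>
    if a = 0 then encodeMatrix A
    else if a = 1 then encodeVector b
    else if a = 2 then encodeVector c
    else 0

/-- The array `a` holds the matrix `B`, row by row. -/
def State.HoldsMatrix {n : ℕ} (s : State) (a : ℕ) (B : Matrix (Fin n) (Fin n) ℤ) : Prop :=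
  ∀ i j : Fin n, s.arr a ((i : ℤ) * n + j) = B i j

/-- The program `M` computes the Smith normal form, together with unimodular transformation
matrices, of every nonsingular integer matrix `A` of positive size `n` in at most `T n A`
steps; the matrices `S, P, Q` are returned in the arrays `0, 1, 2`. -/
def ComputesSNF {ι : Type} (F : ι → ℤ → ℤ → ℤ → ℤ) (M : Prog ι)
    (T : (n : ℕ) → Matrix (Fin n) (Fin n) ℤ → ℕ) : Prop :=
  ∀ (n : ℕ) (A : Matrix (Fin n) (Fin n) ℤ), 0 < n → A.det ≠ 0 →
    ∃ (t : ℕ) (s : State) (S P Q : Matrix (Fin n) (Fin n) ℤ),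
      Exec F M (matrixInput A) t s ∧ t ≤ T n A ∧ IsSNF A S P Q ∧
      s.HoldsMatrix 0 S ∧ s.HoldsMatrix 1 P ∧ s.HoldsMatrix 2 Q

/-- Register `0` holds `N`, and the arrays `0, 1, 2` hold `ε_{-N}, …, ε_N`, `α_{-N}, …, α_N`
and `β_0, …, β_{n-1}`. -/
def State.HoldsRepresentation {n : ℕ} (s : State) (N : ℕ)
    (ε : ℤ → ℕ) (α : ℤ → ℤ) (β : Fin n → ℤ) : Prop :=
  s.reg 0 = N ∧
  (∀ i ∈ Finset.Icc (-(N : ℤ)) (N : ℤ), s.arr 0 i = (ε i : ℤ) ∧ s.arr 1 i = α i) ∧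
  ∀ j : Fin n, s.arr 2 (j : ℤ) = β j

end ConeSeries

/-! Write Δ = |det A|, w_k = ⟨c, h_k⟩ > 0 and x = e^{-τ/Δ} < 1. An integer point z of the polyhedron
is determined by its slack y = b - Az ≥ 0, and A^*A = ΔI gives Δ⟨c, z⟩ = ⟨w, b⟩ - ⟨w, y⟩. The series
is therefore e^{⟨w,b⟩τ/Δ} times the sum of x^{⟨w,y⟩} over those y ∈ ℕⁿ with b - y ∈ Aℤⁿ. By the
Smith normal form this membership means S_jj ∣ (P(b - y))_j for all j (`IsSNF.dvd_iff`). Since every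
S_jj divides σ, the condition depends only on y modulo σ, so each coordinate contributes a geometric
series in x^{σ w_k}, and what remains is a polynomial over the box [0, σ)ⁿ (`boxPoly`,
`hasSum_boxPoly`).

This polynomial has natural coefficients and degree at most nσχ; its coefficients are the ε_i, and
ε_i = 0 for i < 0. A nonzero coefficient comes from an actual integer z, which forces Δ ∣ ⟨w,b⟩ - i,
and σℤⁿ ⊆ Aℤⁿ forces Δ ∣ σ w_k. Hence α_i = (⟨w,b⟩ - i)/Δ and β_k = -σ w_k/Δ are integers where they
matter (`IsConeData.isRepresentation`).

For the running time, the polynomials of the first k coordinates are tabulated for all k ≤ n, all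
exponents i ≤ nσχ and all Δ classes of ℤⁿ/Aℤⁿ, the classes being numbered in mixed radix by S_11, …,
S_nn. Telescoping the sum over one coordinate (`boxPoly_succ_add`) replaces σ summands by three
earlier entries, so one entry costs O(1) and the table O(Δ n · nσχ). The class shifts are tabulated
beforehand in O(Δn²), and the weights come from c Q (ΔS⁻¹) P in O(n²), without forming A^*.

The given program for the Smith normal form runs in a disjoint part of the memory (`Exec.shift`). It
may return another Smith normal form than the one in the statement, but σ is the same
(`IsSNF.last_unique`). -/

namespace ConeSeries

/-! ### Running programs within a time bound -/

section Machine

variable {ι : Type} {F : ι → ℤ → ℤ → ℤ → ℤ}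

/-- The program `p`, started in `s`, halts after at most `T` steps in a state satisfying `post`. -/
def Runs (F : ι → ℤ → ℤ → ℤ → ℤ) (p : Prog ι) (s : State) (T : ℕ) (post : State → Prop) : Prop :=
  ∃ t s', Exec F p s t s' ∧ t ≤ T ∧ post s'

theorem Runs.mono {p : Prog ι} {s : State} {T T' : ℕ} {post post' : State → Prop}
    (h : Runs F p s T post) (hT : T ≤ T') (hpost : ∀ s', post s' → post' s') :
    Runs F p s T' post' := by
  obtain ⟨t, s', he, ht, hp⟩ := h
  exact ⟨t, s', he, ht.trans hT, hpost s' hp⟩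

theorem Runs.seq {p q : Prog ι} {s : State} {T₁ T₂ : ℕ} {mid post : State → Prop}
    (hp : Runs F p s T₁ mid) (hq : ∀ s', mid s' → Runs F q s' T₂ post) :
    Runs F (.seq p q) s (T₁ + T₂) post := by
  obtain ⟨t, s', he, ht, hm⟩ := hp
  obtain ⟨t', s'', he', ht', hpost⟩ := hq s' hm
  exact ⟨t + t', s'', .seq he he', by omega, hpost⟩

theorem Runs.assign {x : ℕ} {e : Expr ι} {s : State} {post : State → Prop}
    (h : post (s.setReg x (e.eval F s))) : Runs F (.assign x e) s (e.cost + 1) post :=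
  ⟨_, _, .assign x e s, le_rfl, h⟩

theorem Runs.store {a : ℕ} {i e : Expr ι} {s : State} {post : State → Prop}
    (h : post (s.setArr a (i.eval F s) (e.eval F s))) :
    Runs F (.store a i e) s (i.cost + e.cost + 1) post :=
  ⟨_, _, .store a i e s, le_rfl, h⟩

theorem Runs.loop_true {e : Expr ι} {p : Prog ι} {s : State} {T₁ T₂ : ℕ} {post : State → Prop}
    (he : e.eval F s ≠ 0) (h : Runs F p s T₁ fun s' => Runs F (.loop e p) s' T₂ post) :
    Runs F (.loop e p) s (e.cost + 1 + T₁ + T₂) post := by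
  obtain ⟨t, s', hp, ht, t', s'', hp', ht', hpost⟩ := h
  exact ⟨_, s'', .loop_true he hp hp', by omega, hpost⟩

theorem Runs.loop_false {e : Expr ι} {p : Prog ι} {s : State} {post : State → Prop}
    (he : e.eval F s = 0) (h : post s) : Runs F (.loop e p) s (e.cost + 1) post :=
  ⟨_, s, .loop_false he, le_rfl, h⟩

/-! ### Relocating the memory used by a program -/

/-- The expression with all registers and arrays renumbered by `x ↦ x + m`. -/
def Expr.shift (m : ℕ) : Expr ι → Expr ι
  | .const k => .const k
  | .reg x => .reg (x + m)
  | .arr a i => .arr (a + m) (i.shift m)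
  | .op o e₁ e₂ => .op o (e₁.shift m) (e₂.shift m)
  | .ext f e₁ e₂ e₃ => .ext f (e₁.shift m) (e₂.shift m) (e₃.shift m)

/-- The program with all registers and arrays renumbered by `x ↦ x + m`. -/
def Prog.shift (m : ℕ) : Prog ι → Prog ι
  | .skip => .skip
  | .assign x e => .assign (x + m) (e.shift m)
  | .store a i e => .store (a + m) (i.shift m) (e.shift m)
  | .seq p q => .seq (p.shift m) (q.shift m)
  | .ite e p q => .ite (e.shift m) (p.shift m) (q.shift m)
  | .loop e p => .loop (e.shift m) (p.shift m)

/-- The memory of `s'` from `m` on is the memory `s`. -/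
structure State.Embeds (m : ℕ) (s s' : State) : Prop where
  reg : ∀ x, s'.reg (x + m) = s.reg x
  arr : ∀ a, s'.arr (a + m) = s.arr a

/-- `s` and `s'` have the same registers and arrays below `m`. -/
structure State.AgreeBelow (m : ℕ) (s s' : State) : Prop where
  reg : ∀ x < m, s'.reg x = s.reg x
  arr : ∀ a < m, s'.arr a = s.arr a

theorem State.AgreeBelow.trans {m : ℕ} {s₁ s₂ s₃ : State} (h : AgreeBelow m s₁ s₂)
    (h' : AgreeBelow m s₂ s₃) : AgreeBelow m s₁ s₃ :=
  ⟨fun x hx => (h'.reg x hx).trans (h.reg x hx), fun a ha => (h'.arr a ha).trans (h.arr a ha)⟩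

theorem Expr.cost_shift (m : ℕ) (e : Expr ι) : (e.shift m).cost = e.cost := by
  induction e <;> simp_all [Expr.shift, Expr.cost]

theorem Expr.eval_shift {m : ℕ} {s s' : State} (h : s.Embeds m s') (e : Expr ι) :
    (e.shift m).eval F s' = e.eval F s := by
  induction e <;> simp_all [Expr.shift, Expr.eval, h.reg, h.arr]

theorem State.Embeds.setReg {m : ℕ} {s s' : State} (h : s.Embeds m s') (x : ℕ) (v : ℤ) :
    (s.setReg x v).Embeds m (s'.setReg (x + m) v) := by
  refine ⟨fun y => ?_, h.arr⟩
  by_cases hy : y = x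
  · simp [State.setReg, hy]
  · simp [State.setReg, Function.update_of_ne, hy, h.reg]

theorem State.Embeds.setArr {m : ℕ} {s s' : State} (h : s.Embeds m s') (a : ℕ) (i v : ℤ) :
    (s.setArr a i v).Embeds m (s'.setArr (a + m) i v) := by
  refine ⟨h.reg, fun y => ?_⟩
  by_cases hy : y = a
  · simp [State.setArr, hy, h.arr]
  · simp [State.setArr, Function.update_of_ne, hy, h.arr]

theorem State.agreeBelow_setReg (m : ℕ) (s : State) (x : ℕ) (v : ℤ) :
    s.AgreeBelow m (s.setReg (x + m) v) :=
  ⟨fun y hy => by simp [State.setReg, Function.update_of_ne (show y ≠ x + m by omega)],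
    fun _ _ => rfl⟩

theorem State.agreeBelow_setArr (m : ℕ) (s : State) (a : ℕ) (i v : ℤ) :
    s.AgreeBelow m (s.setArr (a + m) i v) :=
  ⟨fun _ _ => rfl,
    fun y hy => by simp [State.setArr, Function.update_of_ne (show y ≠ a + m by omega)]⟩

/-- Renumbering changes neither costs nor values, so a run is simulated step by step. This allows a
given program to be used as a subroutine while everything below `m` is preserved. -/
theorem Exec.shift {m : ℕ} {p : Prog ι} {s₁ s₂ : State} {t : ℕ} (h : Exec F p s₁ t s₂) :
    ∀ s₁', s₁.Embeds m s₁' →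
      ∃ s₂', Exec F (p.shift m) s₁' t s₂' ∧ s₂.Embeds m s₂' ∧ s₁'.AgreeBelow m s₂' := by
  induction h with
  | skip s => exact fun s' h => ⟨s', .skip s', h, fun _ _ => rfl, fun _ _ => rfl⟩
  | assign x e s =>
    intro s' h
    have := Exec.assign (F := F) (x + m) (e.shift m) s'
    rw [Expr.cost_shift, Expr.eval_shift h] at this
    exact ⟨_, this, h.setReg _ _, State.agreeBelow_setReg _ _ _ _⟩
  | store a i e s =>
    intro s' h
    have := Exec.store (F := F) (a + m) (i.shift m) (e.shift m) s'
    rw [Expr.cost_shift, Expr.cost_shift, Expr.eval_shift h, Expr.eval_shift h] at this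
    exact ⟨_, this, h.setArr _ _ _, State.agreeBelow_setArr _ _ _ _ _⟩
  | seq _ _ ih₁ ih₂ =>
    intro s' h
    obtain ⟨u, hu, hu', hu''⟩ := ih₁ s' h
    obtain ⟨v, hv, hv', hv''⟩ := ih₂ u hu'
    exact ⟨v, .seq hu hv, hv', hu''.trans hv''⟩
  | @ite_true e _ _ _ _ _ he _ ih =>
    intro s' h
    obtain ⟨u, hu, hu', hu''⟩ := ih s' h
    rw [← Expr.cost_shift m e]
    exact ⟨u, .ite_true (by rwa [Expr.eval_shift h]) hu, hu', hu''⟩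
  | @ite_false e _ _ _ _ _ he _ ih =>
    intro s' h
    obtain ⟨u, hu, hu', hu''⟩ := ih s' h
    rw [← Expr.cost_shift m e]
    exact ⟨u, .ite_false (by rwa [Expr.eval_shift h]) hu, hu', hu''⟩
  | @loop_true e _ _ _ _ _ _ he _ _ ih₁ ih₂ =>
    intro s' h
    obtain ⟨u, hu, hu', hu''⟩ := ih₁ s' h
    obtain ⟨v, hv, hv', hv''⟩ := ih₂ u hu'
    rw [← Expr.cost_shift m e]
    exact ⟨v, .loop_true (by rwa [Expr.eval_shift h]) hu hv, hv', hu''.trans hv''⟩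
  | @loop_false e _ _ he =>
    intro s' h
    rw [← Expr.cost_shift m e]
    exact ⟨s', .loop_false (by rwa [Expr.eval_shift h]), h, fun _ _ => rfl, fun _ _ => rfl⟩

/-! ### Filling an array from left to right -/

/-- `s` and `s'` differ only in the register `1` and the array `a`. -/
structure State.AgreeOff (a : ℕ) (s s' : State) : Prop where
  reg : ∀ y, y ≠ 1 → s'.reg y = s.reg y
  arr : ∀ b, b ≠ a → s'.arr b = s.arr b

/-- `for x < len do a[x] := e`, where `x` is the register `1`. -/
def fill (a : ℕ) (len e : Expr ι) : Prog ι :=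
  .seq (.assign 1 (.const 0))
    (.loop (.op .le (.op .add (.reg 1) (.const 1)) len)
      (.seq (.store a (.reg 1) e) (.assign 1 (.op .add (.reg 1) (.const 1)))))

/-- The loop invariant is that the positions before the counter already hold `f`. Since `e` may read
them, recursively defined arrays are covered. The bound `lenE` is evaluated anew at each round, so
its value must be stable under the changes made by the loop. -/
theorem runs_fill {a : ℕ} {lenE e : Expr ι} {len : ℕ} {f : ℕ → ℤ} {s : State}
    (hlen : ∀ s', s.AgreeOff a s' → (∀ k : ℤ, k < 0 → s'.arr a k = s.arr a k) →
      lenE.eval F s' = len)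
    (he : ∀ s' (x : ℕ), x < len → s.AgreeOff a s' → (∀ k : ℤ, k < 0 → s'.arr a k = s.arr a k) →
      s'.reg 1 = x → (∀ k < x, s'.arr a (k : ℤ) = f k) → e.eval F s' = f x) :
    Runs F (fill a lenE e) s ((len + 1) * (lenE.cost + e.cost + 20)) fun s' =>
      s.AgreeOff a s' ∧
        ∀ k : ℤ, s'.arr a k = if 0 ≤ k ∧ k < len then f k.toNat else s.arr a k := by
  -- Induction on the number `m` of remaining rounds.
  have main : ∀ (m x : ℕ) (s' : State), x + m = len → s.AgreeOff a s' → s'.reg 1 = x →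
      (∀ k : ℤ, s'.arr a k = if 0 ≤ k ∧ k < x then f k.toNat else s.arr a k) →
      Runs F (.loop (.op .le (.op .add (.reg 1) (.const 1)) lenE)
        (.seq (.store a (.reg 1) e) (.assign 1 (.op .add (.reg 1) (.const 1))))) s'
        (m * (lenE.cost + e.cost + 16) + (lenE.cost + 10)) fun s' =>
      s.AgreeOff a s' ∧
        ∀ k : ℤ, s'.arr a k = if 0 ≤ k ∧ k < len then f k.toNat else s.arr a k := by
    intro m
    induction m with
    | zero =>
      intro x s' hx hs hr ha
      have hl : lenE.eval F s' = len := hlen s' hs fun k hk => by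
        rw [ha, if_neg (by omega)]
      refine (Runs.loop_false ?_ ⟨hs, ?_⟩).mono ?_ fun _ h => h
      · simp only [Expr.eval, BinOp.eval, hr, hl]
        rw [if_neg (by omega)]
      · simp only [Expr.cost]; omega
      · have : x = len := by omega
        subst this; exact ha
    | succ m ih =>
      intro x s' hx hs hr ha
      have hl : lenE.eval F s' = len := hlen s' hs fun k hk => by
        rw [ha, if_neg (by omega)]
      have hv : e.eval F s' = f x := he s' x (by omega) hs
        (fun k hk => by rw [ha, if_neg (by omega)]) hr fun k hk => by
          rw [ha, if_pos (by omega)]; simp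
      refine (Runs.loop_true ?_ (Runs.seq (Runs.store rfl) fun s₁ h₁ =>
        Runs.assign (ih (x + 1) _ ?_ ?_ ?_ ?_))).mono ?_ fun _ h => h
      · simp only [Expr.eval, BinOp.eval, hr, hl]
        rw [if_pos (by omega)]; decide
      · omega
      · subst h₁
        refine ⟨fun y hy => ?_, fun b hb => ?_⟩
        · simp [State.setReg, State.setArr, Function.update_of_ne hy, hs.reg y hy]
        · simp [State.setReg, State.setArr, Function.update_of_ne hb, hs.arr b hb]
      · subst h₁
        simp [State.setReg, State.setArr, Expr.eval, BinOp.eval, hr]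
      · subst h₁
        intro k
        simp only [State.setReg, State.setArr, Function.update_self, Expr.eval, hr, hv]
        by_cases hk : k = x
        · subst hk; simp
        · rw [Function.update_of_ne hk, ha]
          congr 1
          simp only [eq_iff_iff]; push_cast; omega
      · simp only [Expr.cost, add_mul, one_mul]; omega
  refine (Runs.seq (Runs.assign rfl) fun s' h => main len 0 s' (by omega) ?_ ?_ ?_).mono ?_
    fun _ h => h
  · subst h
    exact ⟨fun y hy => by simp [State.setReg, Function.update_of_ne hy], fun _ _ => rfl⟩
  · subst h; simp [State.setReg, Expr.eval]
  · subst h; intro k; rw [if_neg (by omega)]; rfl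
  · simp only [Expr.cost, add_mul, one_mul, mul_add]; omega

/-- Register `0` is `n`, the entries of the array `0` at negative positions vanish, and for every
`(a, len, f)` in `Γ` the array `a` begins with `f 0, …, f (len - 1)`. -/
structure State.Sat (n : ℕ) (Γ : List (ℕ × ℕ × (ℕ → ℤ))) (s : State) : Prop where
  reg_zero : s.reg 0 = n
  neg : ∀ k : ℤ, k < 0 → s.arr 0 k = 0
  holds : ∀ r ∈ Γ, ∀ k < r.2.1, s.arr r.1 (k : ℤ) = r.2.2 k

theorem State.Sat.mono {n : ℕ} {Γ Γ' : List (ℕ × ℕ × (ℕ → ℤ))} {s : State} (h : s.Sat n Γ)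
    (hΓ : ∀ r ∈ Γ', r ∈ Γ) : s.Sat n Γ' :=
  ⟨h.reg_zero, h.neg, fun r hr => h.holds r (hΓ r hr)⟩

theorem State.Sat.of_agreeOff {n a : ℕ} {Γ : List (ℕ × ℕ × (ℕ → ℤ))} {s s' : State}
    (h : s.Sat n Γ) (hs : s.AgreeOff a s') (ha : a ∉ Γ.map Prod.fst)
    (hneg : ∀ k : ℤ, k < 0 → s'.arr a k = s.arr a k) : s'.Sat n Γ := by
  refine ⟨(hs.reg 0 (by decide)).trans h.reg_zero, fun k hk => ?_, fun r hr k hk => ?_⟩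
  · by_cases h0 : 0 = a
    · subst h0; rw [hneg k hk, h.neg k hk]
    · rw [hs.arr 0 h0, h.neg k hk]
  · rw [hs.arr r.1 fun h => ha (h ▸ List.mem_map_of_mem hr), h.holds r hr k hk]

/-- The target array does not occur in `Γ`, so everything known about the memory survives and one
fact is added. Consecutive loops can then be chained by letting `Γ` grow. -/
theorem runs_fill_sat {n a len C : ℕ} {Γ : List (ℕ × ℕ × (ℕ → ℤ))} {lenE e : Expr ι}
    (f : ℕ → ℤ) {s : State} (hs : s.Sat n Γ) (ha : a ∉ Γ.map Prod.fst)
    (hC : lenE.cost + e.cost + 20 ≤ C)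
    (hlen : ∀ s' : State, s'.Sat n Γ → lenE.eval F s' = len)
    (he : ∀ (s' : State) (x : ℕ), s'.Sat n Γ → x < len → s'.reg 1 = x →
      (∀ k < x, s'.arr a (k : ℤ) = f k) → e.eval F s' = f x) :
    Runs F (fill a lenE e) s ((len + 1) * C) (State.Sat n ((a, len, f) :: Γ)) := by
  refine (runs_fill (f := f)
    (fun s' h hneg => hlen s' (hs.of_agreeOff h ha hneg))
    (fun s' x hx h hneg hr hk => he s' x (hs.of_agreeOff h ha hneg) hx hr hk)).mono
    (Nat.mul_le_mul_left _ hC) fun s' h => ?_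
  have h' := hs.of_agreeOff h.1 ha fun k hk => by rw [h.2, if_neg (by omega)]
  refine ⟨h'.reg_zero, h'.neg, fun r hr k hk => ?_⟩
  rcases List.mem_cons.1 hr with rfl | hr
  · dsimp only at hk ⊢
    rw [h.2, if_pos (by omega)]; simp
  · exact h'.holds r hr k hk

end Machine

/-! ### Counting the points of a box in a residue class -/

section Box

open Polynomial

/-- The generating polynomial of `∑ l < k, w l * r l`, where `r` runs through the integer vectors
in `[0, σ) ^ k` with `∑ l < k, r l * p j l ≡ v j` modulo `d j` for all `j < n`. -/
noncomputable def boxPoly (n σ : ℕ) (d : ℕ → ℤ) (p : ℕ → ℕ → ℤ) (w : ℕ → ℕ) :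
    ℕ → (ℕ → ℤ) → ℕ[X]
  | 0, v => open Classical in if ∀ j < n, d j ∣ v j then 1 else 0
  | k + 1, v => ∑ r ∈ Finset.range σ, X ^ (w k * r) * boxPoly n σ d p w k fun j => v j - r * p j k

variable {n σ : ℕ} {d : ℕ → ℤ} {p : ℕ → ℕ → ℤ} {w : ℕ → ℕ}

/-- Only the residue class of `v` matters; this makes the table of the dynamic program finite. -/
theorem boxPoly_congr (k : ℕ) {v v' : ℕ → ℤ} (h : ∀ j < n, d j ∣ v j - v' j) :
    boxPoly n σ d p w k v = boxPoly n σ d p w k v' := by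
  induction k generalizing v v' with
  | zero =>
    simp only [boxPoly]
    congr 1
    refine propext (forall₂_congr fun j hj => ?_)
    exact (dvd_iff_dvd_of_dvd_sub (h j hj))
  | succ k ih =>
    simp only [boxPoly]
    refine Finset.sum_congr rfl fun r _ => ?_
    rw [ih]
    intro j hj
    simpa using h j hj

/-- Telescoping: the polynomial at `v` is a₀ + … + a_{σ-1}, and the shifted one times `X ^ w k` is
a₁ + … + a_σ. The extra term a_σ involves `v - σ p`, which is congruent to `v`. Both sides are sums
because ℕ[X] has no subtraction. -/
theorem boxPoly_succ_add (k : ℕ) (v : ℕ → ℤ) (hσ : ∀ j < n, d j ∣ σ) :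
    boxPoly n σ d p w (k + 1) v + X ^ (σ * w k) * boxPoly n σ d p w k v =
      boxPoly n σ d p w k v + X ^ w k * boxPoly n σ d p w (k + 1) fun j => v j - p j k := by
  set a : ℕ → ℕ[X] := fun r => X ^ (w k * r) * boxPoly n σ d p w k fun j => v j - r * p j k
  have h₁ : boxPoly n σ d p w (k + 1) v = ∑ r ∈ Finset.range σ, a r := rfl
  have h₂ : (X ^ w k * boxPoly n σ d p w (k + 1) fun j => v j - p j k) =
      ∑ r ∈ Finset.range σ, a (r + 1) := by
    simp only [boxPoly, Finset.mul_sum, a]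
    refine Finset.sum_congr rfl fun r _ => ?_
    rw [← mul_assoc, ← pow_add]
    congr 2
    · ring
    · funext j; push_cast; ring
  have h₃ : X ^ (σ * w k) * boxPoly n σ d p w k v = a σ := by
    simp only [a]
    rw [mul_comm σ, boxPoly_congr k (v := v) fun j hj => ?_]
    simpa using (hσ j hj).mul_right (p j k)
  have h₄ : boxPoly n σ d p w k v = a 0 := by simp [a]
  rw [h₁, h₂, h₃, h₄, ← Finset.sum_range_succ, Finset.sum_range_succ', add_comm]

theorem coeff_boxPoly_succ (k i : ℕ) (v : ℕ → ℤ) (hσ : ∀ j < n, d j ∣ σ) :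
    ((boxPoly n σ d p w (k + 1) v).coeff i : ℤ) =
      (boxPoly n σ d p w k v).coeff i +
        (if w k ≤ i then
          ((boxPoly n σ d p w (k + 1) fun j => v j - p j k).coeff (i - w k) : ℤ) else 0) -
        (if σ * w k ≤ i then ((boxPoly n σ d p w k v).coeff (i - σ * w k) : ℤ) else 0) := by
  have h := congrArg (fun q => ((q.coeff i : ℕ) : ℤ)) (boxPoly_succ_add (p := p) (w := w) k v hσ)
  simp only [coeff_add, coeff_X_pow_mul', Nat.cast_add, Nat.cast_ite, Nat.cast_zero] at h
  linarith

theorem natDegree_boxPoly_le (k : ℕ) (v : ℕ → ℤ) :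
    (boxPoly n σ d p w k v).natDegree ≤ ∑ l ∈ Finset.range k, w l * σ := by
  induction k generalizing v with
  | zero => simp only [boxPoly]; split_ifs <;> simp
  | succ k ih =>
    rw [boxPoly, Finset.sum_range_succ]
    refine natDegree_sum_le_of_forall_le _ _ fun r hr => ?_
    refine natDegree_mul_le.trans ?_
    rw [natDegree_X_pow, add_comm]
    exact add_le_add (ih _) (Nat.mul_le_mul_left _ (Finset.mem_range.1 hr).le)

/-- Coefficients count box vectors, so a nonzero one has a witness. The upper bounds on its
coordinates are dropped: only the congruences are needed for the integrality of the exponents. -/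
theorem exists_of_coeff_boxPoly_ne_zero (k i : ℕ) (v : ℕ → ℤ)
    (h : (boxPoly n σ d p w k v).coeff i ≠ 0) :
    ∃ r : ℕ → ℕ, ∑ l ∈ Finset.range k, w l * r l = i ∧
      ∀ j < n, d j ∣ v j - ∑ l ∈ Finset.range k, r l * p j l := by
  induction k generalizing v i with
  | zero =>
    simp only [boxPoly] at h
    split_ifs at h with hd
    · refine ⟨0, ?_, by simpa using hd⟩
      by_contra hi
      refine h ?_
      rw [coeff_one, if_neg]
      simpa using Ne.symm hi
    · simp at h
  | succ k ih =>
    rw [boxPoly, finsetSum_coeff] at h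
    obtain ⟨r, -, hr⟩ := Finset.exists_ne_zero_of_sum_ne_zero h
    rw [coeff_X_pow_mul'] at hr
    split_ifs at hr with hle
    · obtain ⟨r', h₁, h₂⟩ := ih _ _ hr
      have hu : ∀ l ∈ Finset.range k, Function.update r' k r l = r' l := fun l hl =>
        Function.update_of_ne (Finset.mem_range.1 hl).ne _ _
      refine ⟨Function.update r' k r, ?_, fun j hj => ?_⟩
      · rw [Finset.sum_range_succ, Finset.sum_congr rfl fun l hl => by rw [hu l hl], h₁]
        simp; omega
      · rw [Finset.sum_range_succ, Finset.sum_congr rfl fun l hl => by rw [hu l hl]]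
        convert h₂ j hj using 1
        simp; ring
    · exact absurd rfl hr

end Box

/-! ### Mixed radix expansions -/

section MixedRadix

variable {d : ℕ → ℤ}

/-- The place values of the mixed radix system with the radices `d 0, d 1, …`. -/
def place (d : ℕ → ℤ) (j : ℕ) : ℤ := ∏ l ∈ Finset.range j, d l

/-- The number with the digits `v 0 % d 0, …, v (n - 1) % d (n - 1)`. -/
def radixIndex (d : ℕ → ℤ) (n : ℕ) (v : ℕ → ℤ) : ℤ :=
  ∑ j ∈ Finset.range n, place d j * (v j % d j)

theorem place_succ (j : ℕ) : place d (j + 1) = place d j * d j := Finset.prod_range_succ _ _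

theorem place_pos {n : ℕ} (hd : ∀ j < n, 0 < d j) {j : ℕ} (hj : j ≤ n) : 0 < place d j :=
  Finset.prod_pos fun l hl => hd l ((Finset.mem_range.1 hl).trans_le hj)

theorem radixIndex_nonneg {n : ℕ} (hd : ∀ j < n, 0 < d j) (v : ℕ → ℤ) : 0 ≤ radixIndex d n v :=
  Finset.sum_nonneg fun j hj => by
    have := Finset.mem_range.1 hj
    exact mul_nonneg (place_pos hd this.le).le (Int.emod_nonneg _ (hd j this).ne')

theorem radixIndex_lt {n : ℕ} (hd : ∀ j < n, 0 < d j) (v : ℕ → ℤ) :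
    radixIndex d n v < place d n := by
  induction n with
  | zero => simp [radixIndex, place]
  | succ n ih =>
    have h₁ := ih fun j hj => hd j (by omega)
    have h₂ := Int.emod_lt_of_pos (v n) (hd n (by omega))
    have h₃ := place_pos hd (Nat.le_succ n)
    rw [radixIndex, Finset.sum_range_succ, place_succ]
    change radixIndex d n v + _ < _
    nlinarith

theorem radixIndex_digit {n : ℕ} (hd : ∀ j < n, 0 < d j) (v : ℕ → ℤ) {j : ℕ} (hj : j < n) :
    radixIndex d n v / place d j % d j = v j % d j := by
  induction n with
  | zero => omega
  | succ n ih =>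
    have hp := place_pos hd hj.le
    have e : radixIndex d (n + 1) v = radixIndex d n v + place d n * (v n % d n) :=
      Finset.sum_range_succ _ _
    rw [e]
    rcases Nat.lt_succ_iff_lt_or_eq.1 hj with h | rfl
    · obtain ⟨q, hq⟩ : place d (j + 1) ∣ place d n :=
        Finset.prod_dvd_prod_of_subset _ _ _ (Finset.range_mono h)
      rw [hq, place_succ, show radixIndex d n v + place d j * d j * q * (v n % d n) =
        radixIndex d n v + place d j * (d j * (q * (v n % d n))) by ring,
        Int.add_mul_ediv_left _ _ hp.ne', Int.add_mul_emod_self_left]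
      exact ih (fun j hj => hd j (by omega)) h
    · have hd' : ∀ l < j, 0 < d l := fun l hl => hd l (by omega)
      rw [Int.add_mul_ediv_left _ _ hp.ne',
        Int.ediv_eq_zero_of_lt (radixIndex_nonneg hd' v) (radixIndex_lt hd' v)]
      simp

/-- The top quotient lies in [0, d n) and is divisible by `d n`, hence is zero; then `g` is below
the next smaller place value. This identifies the trivial residue class in layer 0 of the table. -/
theorem eq_zero_of_digits_eq_zero {n : ℕ} (hd : ∀ j < n, 0 < d j) {g : ℤ} (hg : 0 ≤ g)
    (hlt : g < place d n) (h : ∀ j < n, d j ∣ g / place d j) : g = 0 := by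
  induction n with
  | zero => simp [place] at hlt; omega
  | succ n ih =>
    have hp := place_pos hd (Nat.le_succ n)
    have h₀ : g / place d n = 0 := by
      refine Int.eq_zero_of_dvd_of_nonneg_of_lt (Int.ediv_nonneg hg hp.le) ?_ (h n (by omega))
      rw [place_succ, mul_comm] at hlt
      exact Int.ediv_lt_of_lt_mul hp hlt
    refine ih (fun j hj => hd j (by omega)) ?_ fun j hj => h j (by omega)
    by_contra hc
    have := Int.le_ediv_of_mul_le hp (a := 1) (b := g) (by linarith)
    omega

end MixedRadix

/-! ### The exponential series of a cone -/

section Series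

theorem hasSum_prod_of_nonneg {α β : Type*} {f : α × β → ℝ} {g : α → ℝ} {s : ℝ}
    (hf : ∀ z, 0 ≤ f z) (hfg : ∀ a, HasSum (fun b => f (a, b)) (g a)) (hg : HasSum g s) :
    HasSum f s := by
  have hs : Summable f := (summable_prod_of_nonneg hf).2
    ⟨fun a => (hfg a).summable, by simpa only [(hfg _).tsum_eq] using hg.summable⟩
  have := hs.hasSum.prod_fiberwise hfg
  rw [← this.unique hg]
  exact hs.hasSum

/-- Write a = qσ + r; by periodicity the sum over q is geometric with ratio `x ^ (σ * u)`. -/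
theorem hasSum_periodic_mul_pow {σ u : ℕ} (hσ : 0 < σ) (hu : 0 < u) {x : ℝ} (hx₀ : 0 ≤ x)
    (hx₁ : x < 1) {G : ℕ → ℝ} (hG : ∀ a, 0 ≤ G a) (hper : ∀ a, G (a % σ) = G a) :
    HasSum (fun a => x ^ (u * a) * G a)
      ((∑ r ∈ Finset.range σ, x ^ (u * r) * G r) / (1 - x ^ (σ * u))) := by
  have : NeZero σ := ⟨hσ.ne'⟩
  rw [← (Nat.divModEquiv σ).symm.hasSum_iff]
  refine hasSum_prod_of_nonneg (g := fun q => (x ^ (σ * u)) ^ q *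
    ∑ r ∈ Finset.range σ, x ^ (u * r) * G r) (fun z => ?_) (fun q => ?_) ?_
  · exact mul_nonneg (pow_nonneg hx₀ _) (hG _)
  · rw [Finset.mul_sum, Finset.sum_range]
    convert hasSum_fintype _ using 1
    refine Finset.sum_congr rfl fun r _ => ?_
    have h : (q * σ + r) % σ = r := by
      rw [mul_comm, Nat.mul_add_mod, Nat.mod_eq_of_lt r.2]
    simp only [Function.comp, Nat.divModEquiv_symm_apply]
    rw [← hper (q * σ + r), h, ← mul_assoc, ← pow_mul, ← pow_add]
    congr 2
    ring
  · have h₁ : x ^ (σ * u) < 1 := pow_lt_one₀ hx₀ hx₁ (Nat.mul_pos hσ hu).ne'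
    have := (hasSum_geometric_of_lt_one (pow_nonneg hx₀ (σ * u)) h₁).mul_right
      (∑ r ∈ Finset.range σ, x ^ (u * r) * G r)
    rwa [inv_mul_eq_div] at this

-- Induction on the number of coordinates. For a fixed last coordinate a, the inner sum depends on a
-- only modulo `σ`, because every `d j` divides `σ`, so the periodic geometric series applies.
open Classical in
theorem hasSum_boxPoly {n σ : ℕ} {d : ℕ → ℤ} {p : ℕ → ℕ → ℤ} {w : ℕ → ℕ} (hσ : 0 < σ)
    (hdσ : ∀ j < n, d j ∣ σ) {x : ℝ} (hx₀ : 0 ≤ x) (hx₁ : x < 1) (k : ℕ)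
    (hw : ∀ l < k, 0 < w l) (v : ℕ → ℤ) :
    HasSum (fun y : Fin k → ℕ => if ∀ j < n, d j ∣ v j - ∑ l : Fin k, (y l : ℤ) * p j l then
        x ^ ∑ l : Fin k, w l * y l else 0)
      (Polynomial.aeval x (boxPoly n σ d p w k v) /
        ∏ l ∈ Finset.range k, (1 - x ^ (σ * w l))) := by
  induction k generalizing v with
  | zero =>
    have h := hasSum_fintype fun y : Fin 0 → ℕ =>
      if ∀ j < n, d j ∣ v j - ∑ l : Fin 0, (y l : ℤ) * p j l then x ^ ∑ l : Fin 0, w l * y l else 0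
    convert h using 1
    by_cases h : ∀ j < n, d j ∣ v j
    · simp [boxPoly, if_pos h]
    · simp [boxPoly, if_neg h]
  | succ k ih =>
    have ih' := ih fun l hl => hw l (by omega)
    set G : ℕ → ℝ := fun a => Polynomial.aeval x (boxPoly n σ d p w k fun j => v j - a * p j k) /
      ∏ l ∈ Finset.range k, (1 - x ^ (σ * w l)) with hG
    have hGnonneg : ∀ a, 0 ≤ G a := fun a => (ih' _).nonneg fun y => by
      split_ifs
      · exact pow_nonneg hx₀ _
      · exact le_rfl
    have hper : ∀ a, G (a % σ) = G a := by
      intro a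
      simp only [hG]
      rw [boxPoly_congr k fun j hj => ?_]
      have : (a : ℤ) = (a % σ : ℕ) + σ * (a / σ : ℕ) := by exact_mod_cast (Nat.mod_add_div a σ).symm
      rw [this]
      refine (hdσ j hj).trans ⟨(a / σ : ℕ) * p j k, by push_cast; ring⟩
    have hsum := hasSum_periodic_mul_pow hσ (hw k (by omega)) hx₀ hx₁ hGnonneg hper
    have hval : (∑ r ∈ Finset.range σ, x ^ (w k * r) * G r) / (1 - x ^ (σ * w k)) =
        Polynomial.aeval x (boxPoly n σ d p w (k + 1) v) /
          ∏ l ∈ Finset.range (k + 1), (1 - x ^ (σ * w l)) := by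
      rw [boxPoly, Finset.prod_range_succ, map_sum, ← div_div]
      congr 1
      rw [Finset.sum_div]
      refine Finset.sum_congr rfl fun r _ => ?_
      simp [hG, mul_div_assoc]
    rw [← hval, ← (Fin.snocEquiv fun _ => ℕ).hasSum_iff]
    refine hasSum_prod_of_nonneg (fun z => ?_) (fun a => ?_) hsum
    · dsimp only [Function.comp]
      split_ifs
      · exact pow_nonneg hx₀ _
      · exact le_rfl
    · refine ((ih' fun j => v j - a * p j k).mul_left (x ^ (w k * a))).congr_fun fun y => ?_
      simp only [Function.comp, Fin.snocEquiv_apply, Fin.sum_univ_castSucc, Fin.snoc_castSucc,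
        Fin.snoc_last, Fin.val_castSucc, Fin.val_last, mul_ite, mul_zero, ← pow_add]
      congr 1
      · refine propext (forall₂_congr fun j _ => ?_)
        rw [sub_sub, add_comm (∑ _, _)]
      · rw [add_comm]

end Series

/-! ### Smith normal form and lattice points -/

section Lattice

open Matrix

variable {n : ℕ} {A S P Q : Matrix (Fin n) (Fin n) ℤ} {b c : Fin n → ℤ}

theorem starMatrix_mul_self (A : Matrix (Fin n) (Fin n) ℤ) :
    starMatrix A * A = (A.det.natAbs : ℤ) • (1 : Matrix (Fin n) (Fin n) ℤ) := by
  rw [starMatrix, Matrix.smul_mul, adjugate_mul, smul_smul, Int.sign_mul_self_eq_natAbs]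

theorem vecMul_starMatrix_dotProduct_mulVec (A : Matrix (Fin n) (Fin n) ℤ) (c z : Fin n → ℤ) :
    (c ᵥ* starMatrix A) ⬝ᵥ (A *ᵥ z) = A.det.natAbs * (c ⬝ᵥ z) := by
  rw [dotProduct_mulVec, vecMul_vecMul, starMatrix_mul_self, vecMul_smul, vecMul_one,
    smul_dotProduct, smul_eq_mul]

theorem IsSNF.eq_diagonal (h : IsSNF A S P Q) : S = diagonal fun i => S i i := by
  ext i j
  by_cases hij : i = j
  · subst hij; simp
  · rw [h.off_diag i j hij, diagonal_apply_ne _ hij]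

theorem IsSNF.prod_diag (h : IsSNF A S P Q) : ∏ i, S i i = A.det.natAbs := by
  have h₁ : S.det = ∏ i, S i i := by
    conv_lhs => rw [h.eq_diagonal, det_diagonal]
  have h₂ : S.det = P.det * A.det * Q.det := by rw [h.eq_mul, det_mul, det_mul]
  have h₃ : (S.det.natAbs : ℤ) = S.det :=
    Int.natAbs_of_nonneg (h₁ ▸ Finset.prod_nonneg fun i _ => h.nonneg i)
  rw [← h₁, ← h₃, h₂, Int.natAbs_mul, Int.natAbs_mul, Int.isUnit_iff_natAbs_eq.1 h.unimodular_left,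
    Int.isUnit_iff_natAbs_eq.1 h.unimodular_right, one_mul, mul_one]

theorem IsSNF.diag_pos (h : IsSNF A S P Q) (hA : A.det ≠ 0) (i : Fin n) : 0 < S i i := by
  refine (h.nonneg i).lt_of_ne fun h0 => hA ?_
  have := h.prod_diag
  rw [Finset.prod_eq_zero (f := fun i => S i i) (Finset.mem_univ i) h0.symm] at this
  exact Int.natAbs_eq_zero.1 (by exact_mod_cast this.symm)

/-- P A ℤⁿ = P A Q ℤⁿ = S ℤⁿ, so membership in the lattice A ℤⁿ splits into independent congruences.
-/
theorem IsSNF.dvd_iff (h : IsSNF A S P Q) (u : Fin n → ℤ) :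
    (∀ i, S i i ∣ (P *ᵥ u) i) ↔ ∃ z, A *ᵥ z = u := by
  constructor
  · intro hu
    choose t ht using hu
    refine ⟨Q *ᵥ t, ?_⟩
    have hinj : Function.Injective P.mulVec :=
      mulVec_injective_of_isUnit ((isUnit_iff_isUnit_det P).2 h.unimodular_left)
    refine hinj ?_
    rw [mulVec_mulVec, mulVec_mulVec, ← h.eq_mul, h.eq_diagonal]
    ext i
    rw [mulVec_diagonal, ht]
  · rintro ⟨z, rfl⟩ i
    have hQ : IsUnit Q := (isUnit_iff_isUnit_det Q).2 h.unimodular_right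
    obtain ⟨t, rfl⟩ := (mulVec_surjective_iff_isUnit.2 hQ) z
    rw [mulVec_mulVec, mulVec_mulVec, ← h.eq_mul]
    conv_rhs => rw [h.eq_diagonal]
    rw [mulVec_diagonal]
    exact dvd_mul_right _ _

/-- `Δ A⁻¹ = Q (Δ S⁻¹) P`. -/
theorem IsSNF.starMatrix_eq (h : IsSNF A S P Q) (hA : A.det ≠ 0) :
    starMatrix A = Q * diagonal (fun i => (A.det.natAbs : ℤ) / S i i) * P := by
  have hdvd : ∀ i, S i i ∣ (A.det.natAbs : ℤ) := fun i => by
    rw [← h.prod_diag]; exact Finset.dvd_prod_of_mem _ (Finset.mem_univ i)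
  set D := diagonal (fun i => (A.det.natAbs : ℤ) / S i i) with hD
  have hSD : D * S = (A.det.natAbs : ℤ) • (1 : Matrix (Fin n) (Fin n) ℤ) := by
    conv_lhs => rw [h.eq_diagonal]
    rw [hD, diagonal_mul_diagonal, smul_one_eq_diagonal]
    congr 1; funext i
    exact Int.ediv_mul_cancel (hdvd i)
  have hQ := (isUnit_iff_isUnit_det Q).2 h.unimodular_right
  have key : (Q * D * P) * A = (A.det.natAbs : ℤ) • (1 : Matrix (Fin n) (Fin n) ℤ) := by
    refine hQ.mul_right_cancel ?_
    rw [mul_assoc, mul_assoc, mul_assoc, ← mul_assoc P, ← h.eq_mul, hSD, Matrix.mul_smul,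
      Matrix.smul_mul, mul_one, one_mul]
  -- The two matrices agree after right multiplication by `A`. Multiplying by the adjugate turns
  -- this factor into the scalar det A ≠ 0, which can be cancelled over ℤ.
  have hreg : (starMatrix A - Q * D * P) * A = 0 := by
    rw [sub_mul, key, starMatrix_mul_self, sub_self]
  have h2 : A.det • (starMatrix A - Q * D * P) = 0 := by
    rw [← mul_one (starMatrix A - Q * D * P), ← Matrix.mul_smul, ← mul_adjugate, ← mul_assoc, hreg,
      zero_mul]
  exact sub_eq_zero.1 ((smul_eq_zero.1 h2).resolve_left hA)

/-- The last invariant factor is the exponent of ℤⁿ/Aℤⁿ, hence intrinsic to `A`. One direction holds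
as all factors divide the last; for the other, test on u with P u the last unit vector. -/
theorem IsSNF.last_dvd_iff (h : IsSNF A S P Q) (hn : 0 < n) (k : ℤ) :
    S ⟨n - 1, Nat.sub_lt hn one_pos⟩ ⟨n - 1, Nat.sub_lt hn one_pos⟩ ∣ k ↔
      ∀ u : Fin n → ℤ, ∃ z, A *ᵥ z = k • u := by
  constructor
  · intro hk u
    rw [← h.dvd_iff]
    intro i
    rw [mulVec_smul]
    exact ((h.dvd i _ (Fin.mk_le_mk.2 (by omega) : i ≤ ⟨n - 1, _⟩)).trans hk).mul_right _
  · intro hk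
    obtain ⟨u, hu⟩ := (mulVec_surjective_iff_isUnit.2
      ((isUnit_iff_isUnit_det P).2 h.unimodular_left)) (Pi.single ⟨n - 1, Nat.sub_lt hn one_pos⟩ 1)
    have := (h.dvd_iff _).2 (hk u) ⟨n - 1, Nat.sub_lt hn one_pos⟩
    rwa [mulVec_smul, hu, Pi.smul_apply, Pi.single_eq_same, smul_eq_mul, mul_one] at this

/-- The largest invariant factor does not depend on the choice of the Smith normal form. -/
theorem IsSNF.last_unique {S' P' Q' : Matrix (Fin n) (Fin n) ℤ} (h : IsSNF A S P Q)
    (h' : IsSNF A S' P' Q') (hn : 0 < n) :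
    S ⟨n - 1, Nat.sub_lt hn one_pos⟩ ⟨n - 1, Nat.sub_lt hn one_pos⟩ =
      S' ⟨n - 1, Nat.sub_lt hn one_pos⟩ ⟨n - 1, Nat.sub_lt hn one_pos⟩ :=
  Int.dvd_antisymm (h.nonneg _) (h'.nonneg _)
    ((h.last_dvd_iff hn _).2 ((h'.last_dvd_iff hn _).1 dvd_rfl))
    ((h'.last_dvd_iff hn _).2 ((h.last_dvd_iff hn _).1 dvd_rfl))

/-! ### Slack vectors of integer points and the resulting rational function -/

theorem mem_integerPoints_iff (A : Matrix (Fin n) (Fin n) ℤ) (b z : Fin n → ℤ) :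
    z ∈ integerPoints (polyhedron A b) ↔ ∀ i, (A *ᵥ z) i ≤ b i := by
  simp only [integerPoints, polyhedron, Set.mem_ofPred_eq]
  refine forall_congr' fun i => ?_
  have : (A.map (Int.cast : ℤ → ℝ)).mulVec (fun i => (z i : ℝ)) i = ((A *ᵥ z) i : ℤ) := by
    simp [mulVec, dotProduct]
  rw [this, Int.cast_le]

theorem chi_pos (hn : 0 < n) (hc : ∀ i, 0 < c ⬝ᵥ (starMatrix A).col i) : 0 < chi A c :=
  (Int.natAbs_pos.2 (hc ⟨0, hn⟩).ne').trans_le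
    (Finset.le_sup (f := fun i => (c ⬝ᵥ (starMatrix A).col i).natAbs) (Finset.mem_univ _))

/-- The quantities entering the numerator and the denominator, indexed by natural numbers: the
invariant factors `d`, the entries `p` of `P`, the weights `w = ⟨c, h_k⟩` and `v = P b`. -/
structure IsConeData (A S P Q : Matrix (Fin n) (Fin n) ℤ) (b c : Fin n → ℤ) (σ : ℕ)
    (d : ℕ → ℤ) (p : ℕ → ℕ → ℤ) (w : ℕ → ℕ) (v : ℕ → ℤ) : Prop where
  pos : 0 < n
  det_ne : A.det ≠ 0
  weight_pos : ∀ i, 0 < c ⬝ᵥ (starMatrix A).col i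
  snf : IsSNF A S P Q
  last : S ⟨n - 1, Nat.sub_lt pos one_pos⟩ ⟨n - 1, Nat.sub_lt pos one_pos⟩ = σ
  d_eq : ∀ j : Fin n, d j = S j j
  p_eq : ∀ j k : Fin n, p j k = P j k
  w_eq : ∀ k : Fin n, (w k : ℤ) = c ⬝ᵥ (starMatrix A).col k
  v_eq : ∀ j : Fin n, v j = (P *ᵥ b) j

namespace IsConeData

variable {σ : ℕ} {d : ℕ → ℤ} {p : ℕ → ℕ → ℤ} {w : ℕ → ℕ} {v : ℕ → ℤ}

theorem d_pos (h : IsConeData A S P Q b c σ d p w v) {j : ℕ} (hj : j < n) : 0 < d j := by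
  rw [h.d_eq ⟨j, hj⟩]; exact h.snf.diag_pos h.det_ne _

theorem d_dvd (h : IsConeData A S P Q b c σ d p w v) {j : ℕ} (hj : j < n) : d j ∣ σ := by
  rw [h.d_eq ⟨j, hj⟩, ← h.last]
  exact h.snf.dvd _ _ (Fin.mk_le_mk.2 (by omega))

theorem sigma_pos (h : IsConeData A S P Q b c σ d p w v) : 0 < σ := by
  have := h.snf.diag_pos h.det_ne ⟨n - 1, Nat.sub_lt h.pos one_pos⟩
  rw [h.last] at this
  exact_mod_cast this

theorem w_pos (h : IsConeData A S P Q b c σ d p w v) {k : ℕ} (hk : k < n) : 0 < w k := by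
  have := h.weight_pos ⟨k, hk⟩
  rw [← h.w_eq] at this
  exact_mod_cast this

theorem w_le_chi (h : IsConeData A S P Q b c σ d p w v) {k : ℕ} (hk : k < n) : w k ≤ chi A c := by
  have h₁ := Finset.le_sup (f := fun i => (c ⬝ᵥ (starMatrix A).col i).natAbs)
    (Finset.mem_univ (⟨k, hk⟩ : Fin n))
  rwa [← h.w_eq, Int.natAbs_natCast] at h₁

theorem natDegree_le (h : IsConeData A S P Q b c σ d p w v) :
    (boxPoly n σ d p w n v).natDegree ≤ n * σ * chi A c := by
  refine (natDegree_boxPoly_le n v).trans ?_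
  calc ∑ l ∈ Finset.range n, w l * σ ≤ ∑ _l ∈ Finset.range n, chi A c * σ :=
        Finset.sum_le_sum fun l hl =>
          Nat.mul_le_mul_right _ (h.w_le_chi (Finset.mem_range.1 hl))
    _ = n * σ * chi A c := by simp; ring

theorem sum_w_mul_mulVec (h : IsConeData A S P Q b c σ d p w v) (z : Fin n → ℤ) :
    ∑ k : Fin n, (w k : ℤ) * (A *ᵥ z) k = A.det.natAbs * (c ⬝ᵥ z) := by
  rw [← vecMul_starMatrix_dotProduct_mulVec]
  exact Finset.sum_congr rfl fun k _ => by rw [h.w_eq]; rfl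

theorem exists_mulVec_eq_iff (h : IsConeData A S P Q b c σ d p w v) (y : Fin n → ℤ) :
    (∀ j < n, d j ∣ v j - ∑ l : Fin n, y l * p j l) ↔ ∃ z, A *ᵥ z = b - y := by
  rw [← h.snf.dvd_iff]
  constructor
  · intro hd i
    have := hd i i.2
    rw [h.d_eq, h.v_eq] at this
    rw [mulVec_sub, Pi.sub_apply]
    rwa [Finset.sum_congr rfl fun l _ => by rw [h.p_eq, mul_comm]] at this
  · intro hd j hj
    have := hd ⟨j, hj⟩
    rw [mulVec_sub, Pi.sub_apply, ← h.v_eq, ← h.d_eq] at this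
    rwa [Finset.sum_congr rfl fun (l : Fin n) _ => by rw [h.p_eq ⟨j, hj⟩ l, mul_comm]]

/-- A witness r of the coefficient satisfies ⟨w, r⟩ = i and r = b - Az for an integer z, so the
difference equals Δ⟨c, z⟩. This makes α_i exact whenever ε_i ≠ 0. -/
theorem det_dvd_of_coeff_ne_zero (h : IsConeData A S P Q b c σ d p w v) {i : ℕ}
    (hi : (boxPoly n σ d p w n v).coeff i ≠ 0) :
    (A.det.natAbs : ℤ) ∣ ∑ k : Fin n, (w k : ℤ) * b k - i := by
  obtain ⟨r, h₁, h₂⟩ := exists_of_coeff_boxPoly_ne_zero n i v hi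
  obtain ⟨z, hz⟩ := (h.exists_mulVec_eq_iff fun l => r l).1 fun j hj => by
    have := h₂ j hj
    rwa [Finset.sum_range] at this
  have := h.sum_w_mul_mulVec z
  rw [hz] at this
  refine ⟨c ⬝ᵥ z, ?_⟩
  rw [← this, ← h₁, Finset.sum_range]
  push_cast
  rw [← Finset.sum_sub_distrib]
  exact Finset.sum_congr rfl fun k _ => by simp [mul_sub]

/-- As σ annihilates ℤⁿ/Aℤⁿ, σ e_k = Az for some integer z; pairing with w gives σ w_k = Δ⟨c, z⟩. -/
theorem det_dvd_sigma_mul_w (h : IsConeData A S P Q b c σ d p w v) {k : ℕ} (hk : k < n) :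
    (A.det.natAbs : ℤ) ∣ σ * w k := by
  obtain ⟨z, hz⟩ := (h.snf.last_dvd_iff h.pos σ).1 (h.last ▸ dvd_rfl) (Pi.single ⟨k, hk⟩ 1)
  have := h.sum_w_mul_mulVec z
  rw [hz] at this
  refine ⟨c ⬝ᵥ z, ?_⟩
  rw [← this, Finset.sum_eq_single ⟨k, hk⟩]
  · simp [mul_comm]
  · intro l _ hl; simp [hl]
  · simp

theorem hasSum_integerPoints (h : IsConeData A S P Q b c σ d p w v) {τ : ℝ} (hτ : 0 < τ) :
    HasSum (fun z : integerPoints (polyhedron A b) =>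
        Real.exp (((c ⬝ᵥ (z : Fin n → ℤ) : ℤ) : ℝ) * τ))
      (Real.exp ((∑ k : Fin n, (w k : ℤ) * b k : ℤ) * (τ / A.det.natAbs)) *
        (Polynomial.aeval (Real.exp (-(τ / A.det.natAbs))) (boxPoly n σ d p w n v) /
          ∏ l ∈ Finset.range n, (1 - Real.exp (-(τ / A.det.natAbs)) ^ (σ * w l)))) := by
  classical
  have hΔ : 0 < (A.det.natAbs : ℝ) := by
    exact_mod_cast Int.natAbs_pos.2 h.det_ne
  have hx₁ : Real.exp (-(τ / A.det.natAbs)) < 1 := by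
    rw [Real.exp_lt_one_iff]
    have := div_pos hτ hΔ
    linarith
  have key := (hasSum_boxPoly (p := p) h.sigma_pos (fun j hj => h.d_dvd hj) (Real.exp_nonneg _) hx₁
    n (fun l hl => h.w_pos hl) v).mul_left
      (Real.exp ((∑ k : Fin n, (w k : ℤ) * b k : ℤ) * (τ / A.det.natAbs)))
  set g : integerPoints (polyhedron A b) → Fin n → ℕ :=
    fun z k => (b k - (A *ᵥ (z : Fin n → ℤ)) k).toNat with hg
  have hgz : ∀ z k, (g z k : ℤ) = b k - (A *ᵥ (z : Fin n → ℤ)) k := fun z k =>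
    Int.toNat_of_nonneg (sub_nonneg.2 ((mem_integerPoints_iff A b _).1 z.2 k))
  have hinj : Function.Injective g := by
    intro z z' hzz
    have h₁ : A *ᵥ (z : Fin n → ℤ) = A *ᵥ (z' : Fin n → ℤ) := by
      funext k
      have h₂ := hgz z k
      rw [hzz, hgz z' k] at h₂
      linarith
    exact Subtype.ext (mulVec_injective_of_det_ne_zero h.det_ne h₁)
  -- The slack map `g` is injective since det A ≠ 0, and the summands vanish off its range: a vector
  -- y ≥ 0 satisfying the congruences is b - Az for some z, which then lies in the polyhedron.
  rw [← hinj.hasSum_iff] at key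
  · refine key.congr_fun fun z => Eq.symm ?_
    dsimp only [Function.comp]
    rw [if_pos]
    · have h₁ := h.sum_w_mul_mulVec z
      have h₂ : ∑ k : Fin n, (w k : ℤ) * b k - (∑ l : Fin n, w l * g z l : ℕ) =
          A.det.natAbs * (c ⬝ᵥ (z : Fin n → ℤ)) := by
        rw [← h₁]
        push_cast
        rw [← Finset.sum_sub_distrib]
        exact Finset.sum_congr rfl fun k _ => by rw [hgz]; ring
      have h₃ : ((∑ k : Fin n, (w k : ℤ) * b k : ℤ) : ℝ) - (∑ l : Fin n, w l * g z l : ℕ) =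
          A.det.natAbs * ((c ⬝ᵥ (z : Fin n → ℤ) : ℤ) : ℝ) := by
        generalize A.det.natAbs = D at h₂ ⊢
        exact_mod_cast h₂
      rw [← Real.exp_nat_mul, ← Real.exp_add]
      congr 1
      rw [mul_neg, ← sub_eq_add_neg, ← sub_mul, h₃]
      field_simp
    · refine (h.exists_mulVec_eq_iff fun l => g z l).2 ⟨z, ?_⟩
      funext k
      simp [hgz]
  · intro y hy
    rw [if_neg, mul_zero]
    intro hc
    obtain ⟨z, hz⟩ := (h.exists_mulVec_eq_iff fun l => y l).1 hc
    have hzk : ∀ k, (A *ᵥ z) k = b k - y k := fun k => by rw [hz]; rfl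
    refine hy ⟨⟨z, (mem_integerPoints_iff A b z).2 fun i => ?_⟩, ?_⟩
    · rw [hzk]; omega
    · funext k
      simp [hg, hzk]

theorem isRepresentation (h : IsConeData A S P Q b c σ d p w v)
    {ε : ℤ → ℕ} {α : ℤ → ℤ} {β : Fin n → ℤ}
    (hneg : ∀ i : ℤ, i < 0 → ε i = 0)
    (hε : ∀ i : ℕ, i ≤ n * σ * chi A c → ε i = (boxPoly n σ d p w n v).coeff i)
    (hα : ∀ i : ℕ, i ≤ n * σ * chi A c →
      α i = (∑ k : Fin n, (w k : ℤ) * b k - i) / A.det.natAbs)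
    (hβ : ∀ j : Fin n, β j = -(σ * w j) / A.det.natAbs) :
    IsRepresentation A b c (n * σ * chi A c) ε α β := by
  have hΔ : 0 < (A.det.natAbs : ℤ) := by exact_mod_cast Int.natAbs_pos.2 h.det_ne
  have hΔ' : 0 < (A.det.natAbs : ℝ) := by exact_mod_cast hΔ
  have hβ' : ∀ j, (A.det.natAbs : ℤ) * β j = -(σ * w j) := fun j => by
    rw [hβ, Int.mul_ediv_cancel' ((h.det_dvd_sigma_mul_w j.2).neg_right)]
  refine ⟨fun j => ?_, fun τ hτ => ?_, fun τ hτ => ?_⟩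
  · have h₁ := hβ' j
    have h₂ : (0 : ℤ) < σ * w j := by exact_mod_cast Nat.mul_pos h.sigma_pos (h.w_pos j.2)
    by_contra hc
    have := mul_nonneg hΔ.le (not_lt.1 hc)
    omega
  · simpa only [Real.abs_exp] using (h.hasSum_integerPoints hτ).summable
  · convert h.hasSum_integerPoints hτ using 1
    rw [← mul_div_assoc]
    congr 1
    · rw [Polynomial.aeval_eq_sum_range' (Nat.lt_succ_of_le h.natDegree_le), Finset.mul_sum]
      rw [← Finset.sum_subset (s₁ := (Finset.range (n * σ * chi A c).succ).map Nat.castEmbedding)]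
      · rw [Finset.sum_map]
        refine Finset.sum_congr rfl fun i hi => ?_
        have hi' := Nat.lt_succ_iff.1 (Finset.mem_range.1 hi)
        simp only [Nat.castEmbedding_apply]
        rw [hε i hi', hα i hi']
        -- If the coefficient vanishes, the quotient α_i may have been rounded, but its term is 0
        -- anyway.
        by_cases h0 : (boxPoly n σ d p w n v).coeff i = 0
        · simp [h0]
        · obtain ⟨q, hq⟩ := h.det_dvd_of_coeff_ne_zero h0
          rw [hq, Int.mul_ediv_cancel_left _ hΔ.ne']
          have hq' : ((∑ k : Fin n, (w k : ℤ) * b k : ℤ) : ℝ) = A.det.natAbs * (q : ℝ) + i := by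
            have : ∑ k : Fin n, (w k : ℤ) * b k = A.det.natAbs * q + i := by linarith
            generalize A.det.natAbs = D at this ⊢
            exact_mod_cast this
          rw [hq', ← Real.exp_nat_mul, nsmul_eq_mul, mul_left_comm, ← Real.exp_add]
          congr 2
          field_simp
          ring
      · intro i hi
        obtain ⟨k, hk, rfl⟩ := Finset.mem_map.1 hi
        have := Finset.mem_range.1 hk
        rw [Nat.castEmbedding_apply, Finset.mem_Icc]
        omega
      · intro i hi hi'
        rw [hneg i, Nat.cast_zero, zero_mul]
        by_contra hc
        refine hi' (Finset.mem_map.2 ⟨i.toNat, ?_, ?_⟩)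
        · have := (Finset.mem_Icc.1 hi).2
          rw [Finset.mem_range]; omega
        · simp; omega
    · rw [Finset.prod_range]
      refine Finset.prod_congr rfl fun j _ => ?_
      rw [← Real.exp_nat_mul]
      congr 2
      have : (A.det.natAbs : ℝ) * (β j : ℝ) = -((σ : ℝ) * w j) := by
        have := hβ' j
        generalize A.det.natAbs = D at this ⊢
        exact_mod_cast this
      push_cast
      rw [mul_neg, ← neg_mul, ← this]
      field_simp

theorem exists_isRepresentation (h : IsConeData A S P Q b c σ d p w v) :
    ∃ ε α β, IsRepresentation A b c (n * σ * chi A c) ε α β :=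
  ⟨fun i => if i < 0 then 0 else (boxPoly n σ d p w n v).coeff i.toNat,
    fun i => (∑ k : Fin n, (w k : ℤ) * b k - i) / A.det.natAbs,
    fun j => -(σ * w j) / A.det.natAbs,
    h.isRepresentation (fun _ hi => if_pos hi)
      (fun i _ => by rw [if_neg (by omega), Int.toNat_natCast]) (fun _ _ => rfl) fun _ => rfl⟩

end IsConeData

end Lattice

/-! ### Evaluating expressions -/

section Eval

variable {ι : Type} {F : ι → ℤ → ℤ → ℤ → ℤ} {s : State} {n : ℕ}

instance : Add (Expr ι) := ⟨.op .add⟩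
instance : Sub (Expr ι) := ⟨.op .sub⟩
instance : Mul (Expr ι) := ⟨.op .mul⟩
instance : Div (Expr ι) := ⟨.op .div⟩
instance : Mod (Expr ι) := ⟨.op .mod⟩

@[simp] theorem Expr.eval_add (e₁ e₂ : Expr ι) :
    (e₁ + e₂).eval F s = e₁.eval F s + e₂.eval F s := rfl
@[simp] theorem Expr.eval_sub (e₁ e₂ : Expr ι) :
    (e₁ - e₂).eval F s = e₁.eval F s - e₂.eval F s := rfl
@[simp] theorem Expr.eval_mul (e₁ e₂ : Expr ι) :
    (e₁ * e₂).eval F s = e₁.eval F s * e₂.eval F s := rfl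
@[simp] theorem Expr.eval_div (e₁ e₂ : Expr ι) :
    (e₁ / e₂).eval F s = e₁.eval F s / e₂.eval F s := rfl
@[simp] theorem Expr.eval_mod (e₁ e₂ : Expr ι) :
    (e₁ % e₂).eval F s = e₁.eval F s % e₂.eval F s := rfl
@[simp] theorem Expr.eval_le (e₁ e₂ : Expr ι) :
    (Expr.op .le e₁ e₂).eval F s = if e₁.eval F s ≤ e₂.eval F s then 1 else 0 := rfl
@[simp] theorem Expr.eval_const (k : ℤ) : (Expr.const k : Expr ι).eval F s = k := rfl
@[simp] theorem Expr.eval_reg (x : ℕ) : (Expr.reg x : Expr ι).eval F s = s.reg x := rfl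

@[simp] theorem Expr.cost_add (e₁ e₂ : Expr ι) : (e₁ + e₂).cost = e₁.cost + e₂.cost + 1 := rfl
@[simp] theorem Expr.cost_sub (e₁ e₂ : Expr ι) : (e₁ - e₂).cost = e₁.cost + e₂.cost + 1 := rfl
@[simp] theorem Expr.cost_mul (e₁ e₂ : Expr ι) : (e₁ * e₂).cost = e₁.cost + e₂.cost + 1 := rfl
@[simp] theorem Expr.cost_div (e₁ e₂ : Expr ι) : (e₁ / e₂).cost = e₁.cost + e₂.cost + 1 := rfl
@[simp] theorem Expr.cost_mod (e₁ e₂ : Expr ι) : (e₁ % e₂).cost = e₁.cost + e₂.cost + 1 := rfl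

theorem State.Sat.eval_arr {Γ : List (ℕ × ℕ × (ℕ → ℤ))} (hs : s.Sat n Γ) {a len : ℕ} {f : ℕ → ℤ}
    (h : Γ.lookup a = some (len, f)) {i : Expr ι} {k : ℕ} (hi : i.eval F s = k) (hk : k < len) :
    (Expr.arr a i).eval F s = f k := by
  have hmem : (a, len, f) ∈ Γ := by
    clear hs
    induction Γ with
    | nil => simp at h
    | cons r Γ ih =>
      obtain ⟨a', r⟩ := r
      by_cases ha : a = a'
      · subst ha
        rw [List.lookup_cons_self] at h
        exact Option.some.inj h ▸ List.mem_cons_self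
      · rw [List.lookup_cons, beq_false_of_ne ha] at h
        exact List.mem_cons_of_mem _ (ih h)
  rw [Expr.eval, hi]
  exact hs.holds _ hmem k hk

/-- The value of `step` at `x - 1`, or `z` if `x = 0`, where `x` is the register `1`. -/
def recExpr (z : ℤ) (step : Expr ι → Expr ι) : Expr ι :=
  .op .le (.reg 1) (.const 0) * .const z +
    .op .le (.const 1) (.reg 1) * step (.reg 1 - .const 1)

/-- Filling an array by recursion on the position. -/
theorem runs_rec {a len C : ℕ} {Γ : List (ℕ × ℕ × (ℕ → ℤ))} {lenE : Expr ι} {z : ℤ}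
    {step : Expr ι → Expr ι} (f : ℕ → ℤ) (hs : s.Sat n Γ) (ha : a ∉ Γ.map Prod.fst)
    (hC : lenE.cost + (recExpr z step).cost + 20 ≤ C)
    (hlen : ∀ s' : State, s'.Sat n Γ → lenE.eval F s' = len) (hz : f 0 = z)
    (hstep : ∀ (s' : State) (i : Expr ι) (x : ℕ), s'.Sat n Γ → x + 1 < len → i.eval F s' = x →
      (Expr.arr a i).eval F s' = f x → (step i).eval F s' = f (x + 1)) :
    Runs F (fill a lenE (recExpr z step)) s ((len + 1) * C)
      (State.Sat n ((a, len, f) :: Γ)) := by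
  refine runs_fill_sat f hs ha hC hlen fun s' x hs' hx hr hk => ?_
  cases x with
  -- Comparisons serve as 0/1 factors in place of a conditional: at position 0 the value of `step`
  -- at -1 is multiplied by 0.
  | zero => simp [recExpr, hr, hz]
  | succ x =>
    have hi : (Expr.reg 1 - Expr.const 1 : Expr ι).eval F s' = x := by simp [hr]
    have h := hstep s' _ x hs' hx hi (by rw [Expr.eval, hi]; exact hk x (by omega))
    simp only [recExpr, Expr.eval_add, Expr.eval_mul, Expr.eval_le, Expr.eval_reg, Expr.eval_const,
      h, hr]
    rw [if_neg (by omega), if_pos (by omega)]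
    ring

/-- A sum is computed by tabulating its partial sums; there are `len + 1` of them, the empty one
included. -/
theorem runs_sum {a len C : ℕ} {Γ : List (ℕ × ℕ × (ℕ → ℤ))} {lenE : Expr ι}
    {t : Expr ι → Expr ι} (f : ℕ → ℤ) (hs : s.Sat n Γ) (ha : a ∉ Γ.map Prod.fst)
    (hC : lenE.cost + (recExpr 0 fun i => .arr a i + t i).cost + 20 ≤ C)
    (hlen : ∀ s' : State, s'.Sat n Γ → lenE.eval F s' = (len + 1 : ℕ))
    (ht : ∀ (s' : State) (i : Expr ι) (x : ℕ), s'.Sat n Γ → x < len → i.eval F s' = x →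
      (t i).eval F s' = f x) :
    Runs F (fill a lenE (recExpr 0 fun i => .arr a i + t i)) s ((len + 2) * C)
      (State.Sat n ((a, len + 1, fun x => ∑ y ∈ Finset.range x, f y) :: Γ)) := by
  refine runs_rec _ hs ha hC hlen (by simp) fun s' i x hs' hx hi hk => ?_
  rw [Expr.eval_add, hk, ht s' i x hs' (by omega) hi, Finset.sum_range_succ]

/-- Prefix sums of the concatenation of the rows `g j 0, …, g j (n - 1)`. -/
def rowPrefix (n : ℕ) (g : ℕ → ℕ → ℤ) (x : ℕ) : ℤ := ∑ y ∈ Finset.range x, g (y / n) (y % n)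

/-- The sum of the block `j` of length `n`, from the prefix sums in the array `a`. -/
def blockExpr (a : ℕ) (j : Expr ι) : Expr ι :=
  .arr a ((j + .const 1) * .reg 0) - .arr a (j * .reg 0)

/-- A row sum is the difference of two prefix sums of the concatenated rows. Families of sums, such
as matrix-vector products, thus need only a single loop and no nesting. -/
theorem State.Sat.eval_blockExpr {Γ : List (ℕ × ℕ × (ℕ → ℤ))} (hs : s.Sat n Γ) {a m : ℕ}
    {g : ℕ → ℕ → ℤ} (h : Γ.lookup a =
      some (m * n + 1, rowPrefix n g)) {j : Expr ι} {k : ℕ}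
    (hj : j.eval F s = k) (hk : k < m) :
    (blockExpr a j).eval F s = ∑ i ∈ Finset.range n, g k i := by
  have h₁ : (k + 1) * n ≤ m * n := Nat.mul_le_mul_right _ hk
  rw [blockExpr, Expr.eval_sub, hs.eval_arr h (k := (k + 1) * n) (by simp [hj, hs.reg_zero])
    (by omega), hs.eval_arr h (k := k * n) (by simp [hj, hs.reg_zero])
    (by rw [add_mul] at h₁; omega), rowPrefix, rowPrefix, add_mul, one_mul, Finset.sum_range_add,
      add_sub_cancel_left]
  refine Finset.sum_congr rfl fun i hi => ?_
  have hi := Finset.mem_range.1 hi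
  rw [mul_comm, Nat.mul_add_mod, Nat.mod_eq_of_lt hi, Nat.mul_add_div (by omega),
    Nat.div_eq_of_lt hi, add_zero]

end Eval

/-! ### The dynamic program -/

theorem add_mul_lt_mul {m n i j : ℕ} (hi : i < m) (hj : j < n) : i * n + j < m * n :=
  calc i * n + j < (i + 1) * n := by rw [add_mul]; omega
    _ ≤ m * n := Nat.mul_le_mul_right _ hi

/-- The contents of the memory from which the numerator and the denominator are computed: the
matrices `S`, `P`, `Q`, row by row, the vectors `b` and `c`, the number `Δ`, and the weights
`w k = ⟨c, h_k⟩`. -/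
structure Data where
  (n σ Δ : ℕ)
  (S P Q b c : ℕ → ℤ)
  (w : ℕ → ℕ)

namespace Data

variable (𝒟 : Data)

/-- The invariant factors. -/
def d (j : ℕ) : ℤ := 𝒟.S (j * 𝒟.n + j)

/-- The entries of `P`. -/
def p (j k : ℕ) : ℤ := 𝒟.P (j * 𝒟.n + k)

/-- The entries of `c Q`. -/
def u (j : ℕ) : ℤ := ∑ i ∈ Finset.range 𝒟.n, 𝒟.c i * 𝒟.Q (i * 𝒟.n + j)

/-- The entries of `P b`. -/
def v (j : ℕ) : ℤ := ∑ k ∈ Finset.range 𝒟.n, 𝒟.p j k * 𝒟.b k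

/-- The largest of the first `k` weights. -/
def maxWeight (k : ℕ) : ℕ := (Finset.range k).sup 𝒟.w

/-- The number `n σ χ`. -/
def N : ℕ := 𝒟.n * 𝒟.σ * 𝒟.maxWeight 𝒟.n

/-- The size of one layer of the table of the dynamic program. -/
def L : ℕ := (𝒟.N + 1) * 𝒟.Δ

/-- The digits of `g`. -/
def vec (g : ℕ) (j : ℕ) : ℤ := (g : ℤ) / place 𝒟.d j

/-- The entries `coeff (boxPoly k (vec g)) i`, at the position `k L + i Δ + g`. -/
noncomputable def table (x : ℕ) : ℤ :=
  (boxPoly 𝒟.n 𝒟.σ 𝒟.d 𝒟.p 𝒟.w (x / 𝒟.L) (𝒟.vec (x % 𝒟.Δ))).coeff (x % 𝒟.L / 𝒟.Δ)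

/-- The index of the residue class of `vec g - P e_k`, at the position `k Δ + g`. -/
def shiftTable (y : ℕ) : ℤ :=
  radixIndex 𝒟.d 𝒟.n fun j => 𝒟.vec (y % 𝒟.Δ) j - 𝒟.p j (y / 𝒟.Δ)

/-- The relations between the contents of the memory. -/
structure Valid : Prop where
  n_pos : 0 < 𝒟.n
  σ_pos : 0 < 𝒟.σ
  d_pos : ∀ j < 𝒟.n, 0 < 𝒟.d j
  d_dvd : ∀ j < 𝒟.n, 𝒟.d j ∣ 𝒟.σ
  place_n : place 𝒟.d 𝒟.n = 𝒟.Δ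
  last : 𝒟.S (𝒟.n * 𝒟.n - 1) = 𝒟.σ
  w_pos : ∀ k < 𝒟.n, 0 < 𝒟.w k
  w_eq : ∀ k < 𝒟.n,
    (𝒟.w k : ℤ) = ∑ j ∈ Finset.range 𝒟.n, 𝒟.u j * (𝒟.Δ / 𝒟.d j) * 𝒟.p j k

variable {𝒟}

theorem Valid.Δ_pos (h : 𝒟.Valid) : 0 < 𝒟.Δ := by
  have := place_pos h.d_pos le_rfl
  rw [h.place_n] at this
  exact_mod_cast this

theorem Valid.L_pos (h : 𝒟.Valid) : 0 < 𝒟.L := Nat.mul_pos (Nat.succ_pos _) h.Δ_pos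

theorem table_apply (h : 𝒟.Valid) {i g : ℕ} (k : ℕ) (hi : i ≤ 𝒟.N) (hg : g < 𝒟.Δ) :
    𝒟.table (k * 𝒟.L + (i * 𝒟.Δ + g)) =
      (boxPoly 𝒟.n 𝒟.σ 𝒟.d 𝒟.p 𝒟.w k (𝒟.vec g)).coeff i := by
  have h₁ : i * 𝒟.Δ + g < 𝒟.L := add_mul_lt_mul (Nat.lt_succ_of_le hi) hg
  have h₂ : (k * 𝒟.L + (i * 𝒟.Δ + g)) % 𝒟.Δ = g := by
    rw [L, show k * ((𝒟.N + 1) * 𝒟.Δ) + (i * 𝒟.Δ + g) = 𝒟.Δ * (k * (𝒟.N + 1) + i) + g by ring,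
      Nat.mul_add_mod, Nat.mod_eq_of_lt hg]
  rw [table, h₂, mul_comm k, Nat.mul_add_div h.L_pos, Nat.div_eq_of_lt h₁, Nat.mul_add_mod,
    Nat.mod_eq_of_lt h₁, mul_comm i, Nat.mul_add_div h.Δ_pos, Nat.div_eq_of_lt hg, add_zero,
    add_zero]

/-- Lets any vector be replaced by the one decoded from its index. The entries of `vec g` are not
reduced modulo `d j`, which is harmless by `boxPoly_congr`. -/
theorem vec_radixIndex (h : 𝒟.Valid) (v : ℕ → ℤ) {g : ℕ} (hg : (g : ℤ) = radixIndex 𝒟.d 𝒟.n v) :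
    ∀ j < 𝒟.n, 𝒟.d j ∣ 𝒟.vec g j - v j := fun j hj => by
  rw [vec, hg]
  exact Int.ModEq.dvd (radixIndex_digit h.d_pos v hj).symm

theorem table_zero_layer (h : 𝒟.Valid) {x : ℕ} (hx : x < 𝒟.L) :
    𝒟.table x = if x = 0 then 1 else 0 := by
  have hg : x % 𝒟.Δ < 𝒟.Δ := Nat.mod_lt _ h.Δ_pos
  have h0 : (∀ j < 𝒟.n, 𝒟.d j ∣ 𝒟.vec (x % 𝒟.Δ) j) ↔ x % 𝒟.Δ = 0 := by
    constructor
    · intro hd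
      have := eq_zero_of_digits_eq_zero h.d_pos (Int.natCast_nonneg (x % 𝒟.Δ))
        (by rw [h.place_n]; exact_mod_cast hg) hd
      exact_mod_cast this
    · intro hx j _
      simp [vec, hx]
  rw [table, Nat.div_eq_of_lt hx, Nat.mod_eq_of_lt hx, boxPoly]
  have hdm := Nat.div_add_mod x 𝒟.Δ
  by_cases hx0 : x = 0
  · subst hx0
    rw [if_pos (h0.2 (Nat.zero_mod _))]
    simp
  · rw [if_neg hx0]
    split_ifs with hc
    · rw [h0] at hc
      rw [Polynomial.coeff_one, if_neg]
      · simp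
      · intro h'
        rw [hc, h'] at hdm
        simp at hdm; omega
    · simp

end Data

/-! ### The program after the computation of the Smith normal form -/

namespace Data

variable {ι : Type} {F : ι → ℤ → ℤ → ℤ → ℤ} {𝒟 : Data} {Γ : List (ℕ × ℕ × (ℕ → ℤ))} {s : State}

/-- The invariant factor `S_jj`. -/
def dExpr (j : Expr ι) : Expr ι := Expr.arr 20 (j * Expr.reg 0 + j)

/-- The largest invariant factor. -/
def σExpr : Expr ι := Expr.arr 20 (Expr.reg 0 * Expr.reg 0 - Expr.const 1)

/-- The number `Δ`. -/
def ΔExpr : Expr ι := Expr.arr 3 (Expr.reg 0)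

/-- The number `n σ χ`. -/
def NExpr : Expr ι := Expr.reg 0 * σExpr * Expr.arr 7 (Expr.reg 0)

/-- The size of one layer of the table. -/
def LExpr : Expr ι := (NExpr + Expr.const 1) * ΔExpr

theorem eval_dExpr (hs : s.Sat 𝒟.n Γ) (h20 : Γ.lookup 20 = some (𝒟.n * 𝒟.n, 𝒟.S)) {j : Expr ι}
    {k : ℕ} (hj : j.eval F s = k) (hk : k < 𝒟.n) : (dExpr j).eval F s = 𝒟.d k :=
  hs.eval_arr h20 (by simp [hj, hs.reg_zero]) (add_mul_lt_mul hk hk)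

theorem eval_σExpr (h : 𝒟.Valid) (hs : s.Sat 𝒟.n Γ)
    (h20 : Γ.lookup 20 = some (𝒟.n * 𝒟.n, 𝒟.S)) :
    (σExpr : Expr ι).eval F s = 𝒟.σ := by
  have := Nat.mul_pos h.n_pos h.n_pos
  rw [← h.last]
  refine hs.eval_arr h20 ?_ (by omega)
  rw [Nat.cast_sub this]
  simp [hs.reg_zero]

theorem eval_ΔExpr (h : 𝒟.Valid) (hs : s.Sat 𝒟.n Γ)
    (h3 : Γ.lookup 3 = some (𝒟.n + 1, place 𝒟.d)) : (ΔExpr : Expr ι).eval F s = 𝒟.Δ := by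
  rw [← h.place_n]
  exact hs.eval_arr h3 (by simp [hs.reg_zero]) (by omega)

theorem eval_NExpr (h : 𝒟.Valid) (hs : s.Sat 𝒟.n Γ)
    (h20 : Γ.lookup 20 = some (𝒟.n * 𝒟.n, 𝒟.S))
    (h7 : Γ.lookup 7 = some (𝒟.n + 1, fun k => (𝒟.maxWeight k : ℤ))) :
    (NExpr : Expr ι).eval F s = 𝒟.N := by
  rw [NExpr, Expr.eval_mul, Expr.eval_mul, eval_σExpr h hs h20,
    hs.eval_arr h7 (k := 𝒟.n) (by simp [hs.reg_zero]) (by omega), Expr.eval_reg, hs.reg_zero, N]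
  push_cast
  ring

theorem eval_LExpr (h : 𝒟.Valid) (hs : s.Sat 𝒟.n Γ)
    (h20 : Γ.lookup 20 = some (𝒟.n * 𝒟.n, 𝒟.S)) (h3 : Γ.lookup 3 = some (𝒟.n + 1, place 𝒟.d))
    (h7 : Γ.lookup 7 = some (𝒟.n + 1, fun k => (𝒟.maxWeight k : ℤ))) :
    (LExpr : Expr ι).eval F s = 𝒟.L := by
  simp [LExpr, eval_NExpr h hs h20 h7, eval_ΔExpr h hs h3, L]

/-- The place values. -/
def placeProg : Prog ι :=
  fill 3 (Expr.reg 0 + Expr.const 1) (recExpr 1 fun i => Expr.arr 3 i * dExpr i)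

theorem runs_placeProg (hs : s.Sat 𝒟.n Γ) (ha : 3 ∉ Γ.map Prod.fst)
    (h20 : Γ.lookup 20 = some (𝒟.n * 𝒟.n, 𝒟.S)) :
    Runs F placeProg s ((𝒟.n + 2) * 1000) (State.Sat 𝒟.n ((3, 𝒟.n + 1, place 𝒟.d) :: Γ)) := by
  refine runs_rec _ hs ha
      (by simp [Expr.cost, recExpr, dExpr]) (fun s' hs' => by simp [hs'.reg_zero]) rfl
    fun s' i x hs' hx hi hk => ?_
  rw [Expr.eval_mul, hk, eval_dExpr hs' h20 hi (by omega), place_succ]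

/-- Prefix sums for the vector `c Q`. -/
def uProg : Prog ι :=
  fill 4 (Expr.reg 0 * Expr.reg 0 + Expr.const 1) (recExpr 0 fun i => Expr.arr 4 i +
    Expr.arr 2 (i % Expr.reg 0) * Expr.arr 22 (i % Expr.reg 0 * Expr.reg 0 + i / Expr.reg 0))

theorem div_lt_and_mod_lt {m n x : ℕ} (hx : x < m * n) : x / n < m ∧ x % n < n :=
  ⟨Nat.div_lt_of_lt_mul (by rwa [mul_comm]),
    Nat.mod_lt _ (Nat.pos_of_ne_zero fun h => by simp [h] at hx)⟩

theorem runs_uProg (hs : s.Sat 𝒟.n Γ) (ha : 4 ∉ Γ.map Prod.fst)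
    (h2 : Γ.lookup 2 = some (𝒟.n, 𝒟.c)) (h22 : Γ.lookup 22 = some (𝒟.n * 𝒟.n, 𝒟.Q)) :
    Runs F uProg s ((𝒟.n * 𝒟.n + 2) * 1000)
      (State.Sat 𝒟.n ((4, 𝒟.n * 𝒟.n + 1, rowPrefix 𝒟.n
        fun j i => 𝒟.c i * 𝒟.Q (i * 𝒟.n + j)) :: Γ)) := by
  refine runs_sum _ hs ha (by simp [Expr.cost, recExpr]) (fun s' hs' => by simp [hs'.reg_zero])
    fun s' i x hs' hx hi => ?_
  obtain ⟨h₁, h₂⟩ := div_lt_and_mod_lt hx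
  rw [Expr.eval_mul, hs'.eval_arr h2 (k := x % 𝒟.n) (by simp [hi, hs'.reg_zero]) h₂,
    hs'.eval_arr h22 (k := x % 𝒟.n * 𝒟.n + x / 𝒟.n) (by simp [hi, hs'.reg_zero])
      (add_mul_lt_mul h₂ h₁)]

/-- Prefix sums for the weights `c Q (Δ S⁻¹) P`. -/
def weightSumProg : Prog ι :=
  fill 5 (Expr.reg 0 * Expr.reg 0 + Expr.const 1) (recExpr 0 fun i => Expr.arr 5 i +
    blockExpr 4 (i % Expr.reg 0) * (ΔExpr / dExpr (i % Expr.reg 0)) *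
      Expr.arr 21 (i % Expr.reg 0 * Expr.reg 0 + i / Expr.reg 0))

/-- The row vector c Q is scaled by ΔS⁻¹ and multiplied by P, which costs O(n²), whereas multiplying
the matrices first would not. -/
theorem runs_weightSumProg (h : 𝒟.Valid) (hs : s.Sat 𝒟.n Γ) (ha : 5 ∉ Γ.map Prod.fst)
    (h20 : Γ.lookup 20 = some (𝒟.n * 𝒟.n, 𝒟.S)) (h21 : Γ.lookup 21 = some (𝒟.n * 𝒟.n, 𝒟.P))
    (h3 : Γ.lookup 3 = some (𝒟.n + 1, place 𝒟.d))
    (h4 : Γ.lookup 4 = some (𝒟.n * 𝒟.n + 1, rowPrefix 𝒟.n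
        fun j i => 𝒟.c i * 𝒟.Q (i * 𝒟.n + j))) :
    Runs F weightSumProg s ((𝒟.n * 𝒟.n + 2) * 1000)
      (State.Sat 𝒟.n ((5, 𝒟.n * 𝒟.n + 1, rowPrefix 𝒟.n
        fun k j => 𝒟.u j * (𝒟.Δ / 𝒟.d j) * 𝒟.p j k) :: Γ)) := by
  refine runs_sum _ hs ha
      (by simp [Expr.cost, recExpr, blockExpr, dExpr, ΔExpr]) (fun s' hs' => by simp [hs'.reg_zero])
    fun s' i x hs' hx hi => ?_
  obtain ⟨h₁, h₂⟩ := div_lt_and_mod_lt hx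
  have hi' : (i % Expr.reg 0).eval F s' = ((x % 𝒟.n : ℕ) : ℤ) := by simp [hi, hs'.reg_zero]
  rw [Expr.eval_mul, Expr.eval_mul, Expr.eval_div, hs'.eval_blockExpr h4 hi' h₂,
    eval_ΔExpr h hs' h3, eval_dExpr hs' h20 hi' h₂,
    hs'.eval_arr h21 (k := x % 𝒟.n * 𝒟.n + x / 𝒟.n) (by simp [hi, hs'.reg_zero])
      (add_mul_lt_mul h₂ h₁)]
  rfl

/-- The weights. -/
def weightProg : Prog ι := fill 6 (Expr.reg 0) (blockExpr 5 (Expr.reg 1))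

theorem runs_weightProg (h : 𝒟.Valid) (hs : s.Sat 𝒟.n Γ) (ha : 6 ∉ Γ.map Prod.fst)
    (h5 : Γ.lookup 5 = some (𝒟.n * 𝒟.n + 1, rowPrefix 𝒟.n
        fun k j => 𝒟.u j * (𝒟.Δ / 𝒟.d j) * 𝒟.p j k)) :
    Runs F weightProg s ((𝒟.n + 1) * 1000)
      (State.Sat 𝒟.n ((6, 𝒟.n, fun k => (𝒟.w k : ℤ)) :: Γ)) := by
  refine runs_fill_sat _ hs ha
      (by simp [Expr.cost, blockExpr]) (fun s' hs' => by simp [hs'.reg_zero])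
    fun s' x hs' hx hr _ => ?_
  rw [hs'.eval_blockExpr h5 (k := x) (by simp [hr]) hx, h.w_eq x hx]

/-- The maxima of the first weights. -/
def maxProg : Prog ι :=
  fill 7 (Expr.reg 0 + Expr.const 1) (recExpr 0 fun i => Expr.arr 7 i +
    Expr.op .le (Expr.arr 7 i) (Expr.arr 6 i) * (Expr.arr 6 i - Expr.arr 7 i))

theorem runs_maxProg (hs : s.Sat 𝒟.n Γ) (ha : 7 ∉ Γ.map Prod.fst)
    (h6 : Γ.lookup 6 = some (𝒟.n, fun k => (𝒟.w k : ℤ))) :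
    Runs F maxProg s ((𝒟.n + 2) * 1000)
      (State.Sat 𝒟.n ((7, 𝒟.n + 1, fun k => (𝒟.maxWeight k : ℤ)) :: Γ)) := by
  refine runs_rec _ hs ha (by simp [Expr.cost, recExpr]) (fun s' hs' => by simp [hs'.reg_zero]) rfl
    fun s' i x hs' hx hi hk => ?_
  -- max(m, w) = m + [m ≤ w](w - m).
  rw [Expr.eval_add, Expr.eval_mul, Expr.eval_sub, Expr.eval_le, hk,
    hs'.eval_arr h6 hi (by omega), maxWeight, maxWeight, Finset.range_add_one, Finset.sup_insert,
    Nat.max_def]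
  split_ifs <;> omega

/-- Prefix sums for `∑ k, w k * b k`. -/
def valueProg : Prog ι :=
  fill 8 (Expr.reg 0 + Expr.const 1) (recExpr 0 fun i => Expr.arr 8 i + Expr.arr 6 i * Expr.arr 1 i)

theorem runs_valueProg (hs : s.Sat 𝒟.n Γ) (ha : 8 ∉ Γ.map Prod.fst)
    (h1 : Γ.lookup 1 = some (𝒟.n, 𝒟.b)) (h6 : Γ.lookup 6 = some (𝒟.n, fun k => (𝒟.w k : ℤ))) :
    Runs F valueProg s ((𝒟.n + 2) * 1000)
      (State.Sat 𝒟.n ((8, 𝒟.n + 1, fun x => ∑ y ∈ Finset.range x, 𝒟.w y * 𝒟.b y) :: Γ)) := by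
  refine runs_sum _ hs ha (by simp [Expr.cost, recExpr]) (fun s' hs' => by simp [hs'.reg_zero])
    fun s' i x hs' hx hi => ?_
  rw [Expr.eval_mul, hs'.eval_arr h6 hi hx, hs'.eval_arr h1 hi hx]

/-- Prefix sums for the vector `P b`. -/
def residueSumProg : Prog ι :=
  fill 9 (Expr.reg 0 * Expr.reg 0 + Expr.const 1) (recExpr 0 fun i => Expr.arr 9 i +
    Expr.arr 21 (i / Expr.reg 0 * Expr.reg 0 + i % Expr.reg 0) * Expr.arr 1 (i % Expr.reg 0))

theorem runs_residueSumProg (hs : s.Sat 𝒟.n Γ) (ha : 9 ∉ Γ.map Prod.fst)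
    (h1 : Γ.lookup 1 = some (𝒟.n, 𝒟.b)) (h21 : Γ.lookup 21 = some (𝒟.n * 𝒟.n, 𝒟.P)) :
    Runs F residueSumProg s ((𝒟.n * 𝒟.n + 2) * 1000)
      (State.Sat 𝒟.n ((9, 𝒟.n * 𝒟.n + 1, rowPrefix 𝒟.n
        fun j k => 𝒟.p j k * 𝒟.b k) :: Γ)) := by
  refine runs_sum _ hs ha (by simp [Expr.cost, recExpr]) (fun s' hs' => by simp [hs'.reg_zero])
    fun s' i x hs' hx hi => ?_
  obtain ⟨h₁, h₂⟩ := div_lt_and_mod_lt hx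
  rw [Expr.eval_mul, hs'.eval_arr h1 (k := x % 𝒟.n) (by simp [hi, hs'.reg_zero]) h₂,
    hs'.eval_arr h21 (k := x / 𝒟.n * 𝒟.n + x % 𝒟.n) (by simp [hi, hs'.reg_zero])
      (add_mul_lt_mul h₁ h₂)]
  rfl

/-- Prefix sums for the index of the residue class of `P b`. -/
def residueProg : Prog ι :=
  fill 10 (Expr.reg 0 + Expr.const 1) (recExpr 0 fun i => Expr.arr 10 i +
    Expr.arr 3 i * (blockExpr 9 i % dExpr i))

theorem runs_residueProg (hs : s.Sat 𝒟.n Γ) (ha : 10 ∉ Γ.map Prod.fst)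
    (h20 : Γ.lookup 20 = some (𝒟.n * 𝒟.n, 𝒟.S)) (h3 : Γ.lookup 3 = some (𝒟.n + 1, place 𝒟.d))
    (h9 : Γ.lookup 9 = some (𝒟.n * 𝒟.n + 1, rowPrefix 𝒟.n
        fun j k => 𝒟.p j k * 𝒟.b k)) :
    Runs F residueProg s ((𝒟.n + 2) * 1000)
      (State.Sat 𝒟.n ((10, 𝒟.n + 1, fun x => radixIndex 𝒟.d x 𝒟.v) :: Γ)) := by
  refine runs_sum _ hs ha
      (by simp [Expr.cost, recExpr, blockExpr, dExpr]) (fun s' hs' => by simp [hs'.reg_zero])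
    fun s' i x hs' hx hi => ?_
  rw [Expr.eval_mul, Expr.eval_mod, hs'.eval_arr h3 hi (by omega), hs'.eval_blockExpr h9 hi hx,
    eval_dExpr hs' h20 hi hx]
  rfl

/-- Prefix sums for the indices of the residue classes of `vec g - P e_k`. -/
def shiftSumProg : Prog ι :=
  fill 11 (Expr.reg 0 * ΔExpr * Expr.reg 0 + Expr.const 1) (recExpr 0 fun i => Expr.arr 11 i +
    Expr.arr 3 (i % Expr.reg 0) * ((i / Expr.reg 0 % ΔExpr / Expr.arr 3 (i % Expr.reg 0) -
      Expr.arr 21 (i % Expr.reg 0 * Expr.reg 0 + i / Expr.reg 0 / ΔExpr)) % dExpr (i % Expr.reg 0)))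

/-- Each of the nΔ class shifts needs n digits. They do not depend on the exponent, so tabulating
them once avoids a factor n per entry of the main table. -/
theorem runs_shiftSumProg (h : 𝒟.Valid) (hs : s.Sat 𝒟.n Γ) (ha : 11 ∉ Γ.map Prod.fst)
    (h20 : Γ.lookup 20 = some (𝒟.n * 𝒟.n, 𝒟.S)) (h21 : Γ.lookup 21 = some (𝒟.n * 𝒟.n, 𝒟.P))
    (h3 : Γ.lookup 3 = some (𝒟.n + 1, place 𝒟.d)) :
    Runs F shiftSumProg s ((𝒟.n * 𝒟.Δ * 𝒟.n + 2) * 1000)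
      (State.Sat 𝒟.n ((11, 𝒟.n * 𝒟.Δ * 𝒟.n + 1, rowPrefix 𝒟.n
        fun z j => place 𝒟.d j * ((𝒟.vec (z % 𝒟.Δ) j - 𝒟.p j (z / 𝒟.Δ)) % 𝒟.d j)) :: Γ)) := by
  refine runs_sum _ hs ha (by simp [Expr.cost, recExpr, dExpr, ΔExpr])
    (fun s' hs' => by simp [hs'.reg_zero, eval_ΔExpr h hs' h3]) fun s' i x hs' hx hi => ?_
  obtain ⟨h₁, h₂⟩ := div_lt_and_mod_lt hx
  obtain ⟨h₃, h₄⟩ := div_lt_and_mod_lt h₁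
  have hi' : (i % Expr.reg 0).eval F s' = ((x % 𝒟.n : ℕ) : ℤ) := by simp [hi, hs'.reg_zero]
  rw [Expr.eval_mul, Expr.eval_mod, Expr.eval_sub, Expr.eval_div, Expr.eval_mod, Expr.eval_div,
    eval_ΔExpr h hs' h3, hs'.eval_arr h3 hi' (by omega), eval_dExpr hs' h20 hi' h₂,
    hs'.eval_arr h21 (k := x % 𝒟.n * 𝒟.n + x / 𝒟.n / 𝒟.Δ)
      (by simp [hi, hs'.reg_zero, eval_ΔExpr h hs' h3]) (add_mul_lt_mul h₂ h₃), hi,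
    Expr.eval_reg, hs'.reg_zero]
  simp only [vec, p, Int.natCast_mod, Int.natCast_div]

/-- The indices of the residue classes of `vec g - P e_k`. -/
def shiftProg : Prog ι := fill 12 (Expr.reg 0 * ΔExpr) (blockExpr 11 (Expr.reg 1))

theorem runs_shiftProg (h : 𝒟.Valid) (hs : s.Sat 𝒟.n Γ) (ha : 12 ∉ Γ.map Prod.fst)
    (h3 : Γ.lookup 3 = some (𝒟.n + 1, place 𝒟.d))
    (h11 : Γ.lookup 11 = some (𝒟.n * 𝒟.Δ * 𝒟.n + 1, rowPrefix 𝒟.n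
        fun z j => place 𝒟.d j * ((𝒟.vec (z % 𝒟.Δ) j - 𝒟.p j (z / 𝒟.Δ)) % 𝒟.d j))) :
    Runs F shiftProg s ((𝒟.n * 𝒟.Δ + 1) * 1000)
      (State.Sat 𝒟.n ((12, 𝒟.n * 𝒟.Δ, 𝒟.shiftTable) :: Γ)) := by
  refine runs_fill_sat _ hs ha (by simp [Expr.cost, blockExpr, ΔExpr])
    (fun s' hs' => by simp [hs'.reg_zero, eval_ΔExpr h hs' h3]) fun s' x hs' hx hr _ => ?_
  rw [hs'.eval_blockExpr h11 (k := x) (by simp [hr]) hx]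
  rfl

/-- The weight `w_{k-1}` for the layer `k` containing the current position of the table. -/
def layerWeightExpr : Expr ι := Expr.arr 6 (Expr.reg 1 / LExpr - Expr.const 1)

/-- The exponent `i` of the current position of the table. -/
def exponentExpr : Expr ι := Expr.reg 1 % LExpr / ΔExpr

/-- The table of the coefficients of `boxPoly`. -/
def tableProg : Prog ι :=
  fill 13 ((Expr.reg 0 + Expr.const 1) * LExpr)
    (Expr.op .le (Expr.reg 1) (Expr.const 0) + Expr.op .le LExpr (Expr.reg 1) *
      (Expr.arr 13 (Expr.reg 1 - LExpr) +
        Expr.op .le layerWeightExpr exponentExpr *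
          Expr.arr 13 (Expr.reg 1 - layerWeightExpr * ΔExpr - Expr.reg 1 % ΔExpr +
            Expr.arr 12 ((Expr.reg 1 / LExpr - Expr.const 1) * ΔExpr + Expr.reg 1 % ΔExpr)) -
        Expr.op .le (σExpr * layerWeightExpr) exponentExpr *
          Expr.arr 13 (Expr.reg 1 - LExpr - σExpr * layerWeightExpr * ΔExpr)))

/-- The recurrence `coeff_boxPoly_succ` at constant cost per entry. The table is ordered by layer,
then exponent, then class, so that the three entries read always stand at earlier positions. -/
theorem runs_tableProg (h : 𝒟.Valid) (hs : s.Sat 𝒟.n Γ) (ha : 13 ∉ Γ.map Prod.fst)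
    (h20 : Γ.lookup 20 = some (𝒟.n * 𝒟.n, 𝒟.S))
    (h3 : Γ.lookup 3 = some (𝒟.n + 1, place 𝒟.d))
    (h6 : Γ.lookup 6 = some (𝒟.n, fun k => (𝒟.w k : ℤ)))
    (h7 : Γ.lookup 7 = some (𝒟.n + 1, fun k => (𝒟.maxWeight k : ℤ)))
    (h12 : Γ.lookup 12 = some (𝒟.n * 𝒟.Δ, 𝒟.shiftTable)) :
    Runs F tableProg s (((𝒟.n + 1) * 𝒟.L + 1) * 1000)
      (State.Sat 𝒟.n ((13, (𝒟.n + 1) * 𝒟.L, 𝒟.table) :: Γ)) := by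
  refine runs_fill_sat _ hs ha (by
      simp [Expr.cost, layerWeightExpr, exponentExpr, LExpr, NExpr, σExpr, ΔExpr])
    (fun s' hs' => by simp [hs'.reg_zero, eval_LExpr h hs' h20 h3 h7]) fun s' x hs' hx hr hk => ?_
  have hL := eval_LExpr (F := F) h hs' h20 h3 h7
  have hΔ := eval_ΔExpr (F := F) h hs' h3
  have hσ := eval_σExpr (F := F) h hs' h20
  rcases lt_or_ge x 𝒟.L with hxL | hxL
  · rw [table_zero_layer h hxL]
    simp only [Expr.eval_add, Expr.eval_mul, Expr.eval_le, hL, Expr.eval_reg, hr, Expr.eval_const]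
    rw [if_neg (c := (𝒟.L : ℤ) ≤ x) (by omega), zero_mul, add_zero]
    simp
  obtain ⟨k, i, g, hi, hg, rfl⟩ : ∃ k i g, i ≤ 𝒟.N ∧ g < 𝒟.Δ ∧
      x = (k + 1) * 𝒟.L + (i * 𝒟.Δ + g) := by
    have h₁ : 1 ≤ x / 𝒟.L := (Nat.one_le_div_iff h.L_pos).2 hxL
    obtain ⟨h₂, h₃⟩ := div_lt_and_mod_lt (Nat.mod_lt x h.L_pos : x % 𝒟.L < (𝒟.N + 1) * 𝒟.Δ)
    refine ⟨x / 𝒟.L - 1, x % 𝒟.L / 𝒟.Δ, x % 𝒟.L % 𝒟.Δ, by omega, h₃, ?_⟩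
    rw [Nat.sub_add_cancel h₁, Nat.div_add_mod', Nat.div_add_mod']
  have hlt : i * 𝒟.Δ + g < 𝒟.L := add_mul_lt_mul (Nat.lt_succ_of_le hi) hg
  set x := (k + 1) * 𝒟.L + (i * 𝒟.Δ + g) with hxdef
  have hdiv : x / 𝒟.L = k + 1 := by
    rw [hxdef, mul_comm, Nat.mul_add_div h.L_pos, Nat.div_eq_of_lt hlt, add_zero]
  have hmod : x % 𝒟.L = i * 𝒟.Δ + g := by
    rw [hxdef, mul_comm, Nat.mul_add_mod, Nat.mod_eq_of_lt hlt]
  have hexp : x % 𝒟.L / 𝒟.Δ = i := by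
    rw [hmod, mul_comm, Nat.mul_add_div h.Δ_pos, Nat.div_eq_of_lt hg, add_zero]
  have hres : x % 𝒟.Δ = g := by
    rw [← Nat.mod_mod_of_dvd x (Dvd.intro_left _ rfl : 𝒟.Δ ∣ 𝒟.L), hmod, mul_comm,
      Nat.mul_add_mod, Nat.mod_eq_of_lt hg]
  have hkn : k < 𝒟.n := by
    have := Nat.div_lt_of_lt_mul (by rwa [mul_comm] at hx : x < 𝒟.L * (𝒟.n + 1))
    omega
  have hlayer : (Expr.reg 1 / LExpr - Expr.const 1 : Expr ι).eval F s' = k := by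
    simp only [Expr.eval_sub, Expr.eval_div, Expr.eval_reg, hr, hL, Expr.eval_const,
      ← Int.natCast_div, hdiv]
    simp
  have hw : (layerWeightExpr : Expr ι).eval F s' = (𝒟.w k : ℤ) := hs'.eval_arr h6 hlayer hkn
  have hexpE : (exponentExpr : Expr ι).eval F s' = i := by
    simp only [exponentExpr, Expr.eval_div, Expr.eval_mod, Expr.eval_reg, hr, hL, hΔ,
      ← Int.natCast_div, ← Int.natCast_mod, hexp]
  have hresE : (Expr.reg 1 % ΔExpr : Expr ι).eval F s' = g := by
    simp only [Expr.eval_mod, Expr.eval_reg, hr, hΔ, ← Int.natCast_mod, hres]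
  -- `g'` is the index of the class of `vec g - P e_k`.
  obtain ⟨g', hg'⟩ := Int.eq_ofNat_of_zero_le
    (radixIndex_nonneg h.d_pos fun j => 𝒟.vec g j - 𝒟.p j k)
  have hg'lt : g' < 𝒟.Δ := by
    have := radixIndex_lt h.d_pos fun j => 𝒟.vec g j - 𝒟.p j k
    rw [hg', h.place_n] at this
    exact_mod_cast this
  have hshift : (Expr.arr 12 ((Expr.reg 1 / LExpr - Expr.const 1) * ΔExpr + Expr.reg 1 % ΔExpr) :
      Expr ι).eval F s'
      = g' := by
    rw [hs'.eval_arr h12 (k := k * 𝒟.Δ + g)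
      (by rw [Expr.eval_add, Expr.eval_mul, hlayer, hΔ, hresE]; push_cast; rfl)
      (add_mul_lt_mul hkn hg), shiftTable, mul_comm, Nat.mul_add_mod, Nat.mod_eq_of_lt hg,
      Nat.mul_add_div h.Δ_pos, Nat.div_eq_of_lt hg, add_zero, hg']
  have hfst : (Expr.arr 13 (Expr.reg 1 - LExpr) : Expr ι).eval F s' =
      (boxPoly 𝒟.n 𝒟.σ 𝒟.d 𝒟.p 𝒟.w k (𝒟.vec g)).coeff i := by
    rw [← table_apply h k hi hg, ← hk (k * 𝒟.L + (i * 𝒟.Δ + g)) (by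
      have := h.L_pos
      rw [hxdef, add_mul]; omega), Expr.eval, Expr.eval_sub, Expr.eval_reg, hr, hL, hxdef]
    congr 1
    push_cast
    ring
  have hsnd : 𝒟.w k ≤ i → (Expr.arr 13 (Expr.reg 1 - layerWeightExpr * ΔExpr - Expr.reg 1 % ΔExpr +
        Expr.arr 12 ((Expr.reg 1 / LExpr - Expr.const 1) * ΔExpr + Expr.reg 1 % ΔExpr)) : Expr
          ι).eval F s' =
      (boxPoly 𝒟.n 𝒟.σ 𝒟.d 𝒟.p 𝒟.w (k + 1) fun j => 𝒟.vec g j - 𝒟.p j k).coeff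
        (i - 𝒟.w k) := by
    intro hle
    -- Although `g'` may exceed `g`, the position is earlier: `w k > 0` lowers the exponent, and the
    -- classes of a smaller exponent all come before.
    have hlt' : (i - 𝒟.w k) * 𝒟.Δ + g' < i * 𝒟.Δ :=
      add_mul_lt_mul (Nat.sub_lt_self (h.w_pos k hkn) hle) hg'lt
    rw [← boxPoly_congr (k + 1) (vec_radixIndex h _ hg'.symm),
      ← table_apply h (k + 1) (i := i - 𝒟.w k) (by omega) hg'lt,
      ← hk _ (by rw [hxdef]; omega), Expr.eval, Expr.eval_add, hshift, Expr.eval_sub, hresE,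
      Expr.eval_sub, Expr.eval_mul, hw, hΔ, Expr.eval_reg, hr, hxdef]
    congr 1
    push_cast [Nat.cast_sub hle]
    ring
  have hthd : 𝒟.σ * 𝒟.w k ≤ i →
      (Expr.arr 13 (Expr.reg 1 - LExpr - σExpr * layerWeightExpr * ΔExpr) : Expr ι).eval F s' =
      (boxPoly 𝒟.n 𝒟.σ 𝒟.d 𝒟.p 𝒟.w k (𝒟.vec g)).coeff (i - 𝒟.σ * 𝒟.w k) := by
    intro hle
    have hle' : (i - 𝒟.σ * 𝒟.w k) * 𝒟.Δ ≤ i * 𝒟.Δ := Nat.mul_le_mul_right _ (Nat.sub_le _ _)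
    rw [← table_apply h k (i := i - 𝒟.σ * 𝒟.w k) (by omega) hg,
      ← hk _ (by
        have := h.L_pos
        rw [hxdef, add_mul]; omega), Expr.eval, Expr.eval_sub, Expr.eval_sub, Expr.eval_mul,
      Expr.eval_mul, hσ, hw, hΔ, hL, Expr.eval_reg, hr, hxdef]
    congr 1
    push_cast [Nat.cast_sub hle]
    ring
  rw [hxdef, table_apply h (k + 1) hi hg, coeff_boxPoly_succ k i _ h.d_dvd]
  simp only [Expr.eval_add (Expr.op .le _ _), Expr.eval_sub (Expr.arr 13 _ + _), Expr.eval_add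
      (Expr.arr 13 _),
    Expr.eval_mul (Expr.op .le _ _), Expr.eval_le, hfst, hw, hexpE, Expr.eval_mul σExpr, hσ,
    Expr.eval_reg, hr, hL, Expr.eval_const]
  have := h.L_pos
  rw [if_neg (c := (x : ℤ) ≤ 0) (by omega), if_pos (c := (𝒟.L : ℤ) ≤ x) (by omega), zero_add,
    one_mul]
  have e₁ : ((𝒟.w k : ℤ) ≤ i) ↔ 𝒟.w k ≤ i := by exact_mod_cast Iff.rfl
  have e₂ : ((𝒟.σ : ℤ) * 𝒟.w k ≤ i) ↔ 𝒟.σ * 𝒟.w k ≤ i := by exact_mod_cast Iff.rfl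
  -- When a comparison fails, the array read may be meaningless, but it is multiplied by 0.
  simp only [e₁, e₂]
  congr 1
  · congr 1
    split_ifs with hc
    · rw [one_mul, hsnd hc]
    · rw [zero_mul]
  · split_ifs with hc
    · rw [one_mul, hthd hc]
    · rw [zero_mul]

/-- The coefficients `ε`. -/
def epsilonProg : Prog ι :=
  fill 0 (NExpr + Expr.const 1)
    (Expr.arr 13 (Expr.reg 0 * LExpr + (Expr.reg 1 * ΔExpr + Expr.arr 10 (Expr.reg 0))))

/-- The numerator is the row of the last layer belonging to the class of P b. -/
theorem runs_epsilonProg (h : 𝒟.Valid) (hs : s.Sat 𝒟.n Γ) (ha : 0 ∉ Γ.map Prod.fst)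
    (h20 : Γ.lookup 20 = some (𝒟.n * 𝒟.n, 𝒟.S))
    (h3 : Γ.lookup 3 = some (𝒟.n + 1, place 𝒟.d))
    (h7 : Γ.lookup 7 = some (𝒟.n + 1, fun k => (𝒟.maxWeight k : ℤ)))
    (h10 : Γ.lookup 10 = some (𝒟.n + 1, fun x => radixIndex 𝒟.d x 𝒟.v))
    (h13 : Γ.lookup 13 = some ((𝒟.n + 1) * 𝒟.L, 𝒟.table)) :
    Runs F epsilonProg s ((𝒟.N + 2) * 1000)
      (State.Sat 𝒟.n ((0, 𝒟.N + 1, fun i =>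
        ((boxPoly 𝒟.n 𝒟.σ 𝒟.d 𝒟.p 𝒟.w 𝒟.n 𝒟.v).coeff i : ℤ)) :: Γ)) := by
  refine runs_fill_sat _ hs ha (by simp [Expr.cost, LExpr, NExpr, σExpr, ΔExpr])
    (fun s' hs' => by simp [eval_NExpr h hs' h20 h7]) fun s' x hs' hx hr _ => ?_
  obtain ⟨g, hg⟩ := Int.eq_ofNat_of_zero_le (radixIndex_nonneg h.d_pos 𝒟.v)
  have hglt : g < 𝒟.Δ := by
    have := radixIndex_lt h.d_pos 𝒟.v
    rw [hg, h.place_n] at this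
    exact_mod_cast this
  have hE : (Expr.arr 10 (Expr.reg 0) : Expr ι).eval F s' = g := by
    rw [hs'.eval_arr h10 (k := 𝒟.n) (by simp [hs'.reg_zero]) (by omega), hg]
  rw [hs'.eval_arr h13 (k := 𝒟.n * 𝒟.L + (x * 𝒟.Δ + g))
    (by simp [hs'.reg_zero, eval_LExpr h hs' h20 h3 h7, eval_ΔExpr h hs' h3, hr, hE])
    (add_mul_lt_mul (Nat.lt_succ_self _) (add_mul_lt_mul hx hglt)),
    table_apply h 𝒟.n (by omega) hglt, boxPoly_congr 𝒟.n (vec_radixIndex h _ hg.symm)]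

/-- The exponents `α`. -/
def alphaProg : Prog ι :=
  fill 1 (NExpr + Expr.const 1) ((Expr.arr 8 (Expr.reg 0) - Expr.reg 1) / ΔExpr)

theorem runs_alphaProg (h : 𝒟.Valid) (hs : s.Sat 𝒟.n Γ) (ha : 1 ∉ Γ.map Prod.fst)
    (h20 : Γ.lookup 20 = some (𝒟.n * 𝒟.n, 𝒟.S))
    (h3 : Γ.lookup 3 = some (𝒟.n + 1, place 𝒟.d))
    (h7 : Γ.lookup 7 = some (𝒟.n + 1, fun k => (𝒟.maxWeight k : ℤ)))
    (h8 : Γ.lookup 8 = some (𝒟.n + 1, fun x => ∑ y ∈ Finset.range x, 𝒟.w y * 𝒟.b y)) :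
    Runs F alphaProg s ((𝒟.N + 2) * 1000)
      (State.Sat 𝒟.n ((1, 𝒟.N + 1, fun i =>
        (∑ y ∈ Finset.range 𝒟.n, 𝒟.w y * 𝒟.b y - i) / 𝒟.Δ) :: Γ)) := by
  refine runs_fill_sat _ hs ha (by simp [Expr.cost, NExpr, σExpr, ΔExpr])
    (fun s' hs' => by simp [eval_NExpr h hs' h20 h7]) fun s' x hs' hx hr _ => ?_
  rw [Expr.eval_div, Expr.eval_sub, eval_ΔExpr h hs' h3, Expr.eval_reg, hr,
    hs'.eval_arr h8 (k := 𝒟.n) (by simp [hs'.reg_zero]) (by omega)]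

/-- The exponents `β`. -/
def betaProg : Prog ι :=
  fill 2 (Expr.reg 0) ((Expr.const 0 - σExpr * Expr.arr 6 (Expr.reg 1)) / ΔExpr)

theorem runs_betaProg (h : 𝒟.Valid) (hs : s.Sat 𝒟.n Γ) (ha : 2 ∉ Γ.map Prod.fst)
    (h20 : Γ.lookup 20 = some (𝒟.n * 𝒟.n, 𝒟.S))
    (h3 : Γ.lookup 3 = some (𝒟.n + 1, place 𝒟.d))
    (h6 : Γ.lookup 6 = some (𝒟.n, fun k => (𝒟.w k : ℤ))) :
    Runs F betaProg s ((𝒟.n + 1) * 1000)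
      (State.Sat 𝒟.n ((2, 𝒟.n, fun j => -(𝒟.σ * 𝒟.w j : ℤ) / 𝒟.Δ) :: Γ)) := by
  refine runs_fill_sat _ hs ha (by simp [Expr.cost, σExpr, ΔExpr])
    (fun s' hs' => by simp [hs'.reg_zero]) fun s' x hs' hx hr _ => ?_
  rw [Expr.eval_div, Expr.eval_sub, Expr.eval_mul, eval_ΔExpr h hs' h3, eval_σExpr h hs' h20,
    hs'.eval_arr h6 (k := x) (by simp [hr]) hx, Expr.eval_const, zero_sub]

/-- The computation of the representation from the Smith normal form. -/
def conePart : Prog ι :=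
  .seq placeProg <| .seq uProg <| .seq weightSumProg <| .seq weightProg <| .seq maxProg <|
    .seq valueProg <| .seq residueSumProg <| .seq residueProg <| .seq shiftSumProg <|
      .seq shiftProg <| .seq tableProg <| .seq epsilonProg <| .seq alphaProg <| .seq betaProg <|
        .assign 0 NExpr

theorem Valid.maxWeight_pos (h : 𝒟.Valid) : 0 < 𝒟.maxWeight 𝒟.n :=
  (h.w_pos 0 h.n_pos).trans_le (Finset.le_sup (Finset.mem_range.2 h.n_pos))

theorem runs_conePart (h : 𝒟.Valid)
    (hs : s.Sat 𝒟.n [(20, 𝒟.n * 𝒟.n, 𝒟.S), (21, 𝒟.n * 𝒟.n, 𝒟.P), (22, 𝒟.n * 𝒟.n, 𝒟.Q),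
      (1, 𝒟.n, 𝒟.b), (2, 𝒟.n, 𝒟.c)]) :
    Runs F conePart s (80000 * (𝒟.Δ * 𝒟.n ^ 2 * 𝒟.σ * 𝒟.maxWeight 𝒟.n)) fun s' =>
      s'.reg 0 = 𝒟.N ∧ (∀ i : ℤ, i < 0 → s'.arr 0 i = 0) ∧
      (∀ i : ℕ, i ≤ 𝒟.N →
        s'.arr 0 i = (boxPoly 𝒟.n 𝒟.σ 𝒟.d 𝒟.p 𝒟.w 𝒟.n 𝒟.v).coeff i) ∧
      (∀ i : ℕ, i ≤ 𝒟.N →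
        s'.arr 1 i = (∑ y ∈ Finset.range 𝒟.n, 𝒟.w y * 𝒟.b y - i) / 𝒟.Δ) ∧
      ∀ j < 𝒟.n, s'.arr 2 (j : ℤ) = -(𝒟.σ * 𝒟.w j : ℤ) / 𝒟.Δ := by
  set W := 𝒟.Δ * 𝒟.n ^ 2 * 𝒟.σ * 𝒟.maxWeight 𝒟.n with hW
  have hn := h.n_pos
  have hσ := h.σ_pos
  have hΔ := h.Δ_pos
  have hχ := h.maxWeight_pos
  have hN₁ : 1 ≤ 𝒟.N := Nat.mul_pos (Nat.mul_pos hn hσ) hχ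
  have hW' : W = 𝒟.Δ * 𝒟.n * 𝒟.N := by rw [hW, N]; ring
  have b₁ : 𝒟.n * 𝒟.Δ * 𝒟.n ≤ W := by
    rw [hW, show 𝒟.Δ * 𝒟.n ^ 2 * 𝒟.σ * 𝒟.maxWeight 𝒟.n =
      𝒟.n * 𝒟.Δ * 𝒟.n * (𝒟.σ * 𝒟.maxWeight 𝒟.n) by ring]
    exact Nat.le_mul_of_pos_right _ (Nat.mul_pos hσ hχ)
  have b₂ : 𝒟.n * 𝒟.Δ ≤ 𝒟.n * 𝒟.Δ * 𝒟.n := Nat.le_mul_of_pos_right _ hn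
  have b₃ : 𝒟.n * 𝒟.n ≤ 𝒟.n * 𝒟.Δ * 𝒟.n :=
    Nat.mul_le_mul_right _ (Nat.le_mul_of_pos_right _ hΔ)
  have b₄ : 𝒟.n ≤ 𝒟.n * 𝒟.n := Nat.le_mul_of_pos_right _ hn
  have b₅ : 𝒟.N ≤ W := hW' ▸ Nat.le_mul_of_pos_left _ (Nat.mul_pos hΔ hn)
  have b₆ : (𝒟.n + 1) * 𝒟.L ≤ 4 * W :=
    calc (𝒟.n + 1) * ((𝒟.N + 1) * 𝒟.Δ) ≤ (𝒟.n + 𝒟.n) * ((𝒟.N + 𝒟.N) * 𝒟.Δ) := by gcongr; omega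
      _ = 4 * W := by rw [hW']; ring
  -- The main table contributes 4W, each of the other 13 loops at most W, and the additive constants
  -- sum to 24. As W ≥ 1, the total is at most 41020 W.
  refine Runs.mono (T := (𝒟.n + 2) * 1000 + ((𝒟.n * 𝒟.n + 2) * 1000 + ((𝒟.n * 𝒟.n + 2) * 1000 +
    ((𝒟.n + 1) * 1000 + ((𝒟.n + 2) * 1000 + ((𝒟.n + 2) * 1000 + ((𝒟.n * 𝒟.n + 2) * 1000 +
    ((𝒟.n + 2) * 1000 + ((𝒟.n * 𝒟.Δ * 𝒟.n + 2) * 1000 + ((𝒟.n * 𝒟.Δ + 1) * 1000 +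
    (((𝒟.n + 1) * 𝒟.L + 1) * 1000 + ((𝒟.N + 2) * 1000 + ((𝒟.N + 2) * 1000 +
    ((𝒟.n + 1) * 1000 + 20)))))))))))))) ?_ (by omega) fun _ h => h
  refine Runs.seq (runs_placeProg hs (by simp) rfl) fun s hs => ?_
  refine Runs.seq (runs_uProg hs (by simp) rfl rfl) fun s hs => ?_
  refine Runs.seq (runs_weightSumProg h hs (by simp) rfl rfl rfl rfl) fun s hs => ?_
  refine Runs.seq (runs_weightProg h hs (by simp) rfl) fun s hs => ?_
  refine Runs.seq (runs_maxProg hs (by simp) rfl) fun s hs => ?_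
  refine Runs.seq (runs_valueProg hs (by simp) rfl rfl) fun s hs => ?_
  refine Runs.seq (runs_residueSumProg hs (by simp) rfl rfl) fun s hs => ?_
  refine Runs.seq (runs_residueProg hs (by simp) rfl rfl rfl) fun s hs => ?_
  refine Runs.seq (runs_shiftSumProg h hs (by simp) rfl rfl rfl) fun s hs => ?_
  refine Runs.seq (runs_shiftProg h hs (by simp) rfl rfl) fun s hs => ?_
  refine Runs.seq (runs_tableProg h hs (by simp) rfl rfl rfl rfl rfl) fun s hs => ?_
  -- The facts about `b` and `c` in the arrays 1 and 2 are discarded, since the output overwrites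
  -- them.
  replace hs := hs.mono (Γ' := [(20, 𝒟.n * 𝒟.n, 𝒟.S), (3, 𝒟.n + 1, place 𝒟.d),
    (6, 𝒟.n, fun k => (𝒟.w k : ℤ)), (7, 𝒟.n + 1, fun k => (𝒟.maxWeight k : ℤ)),
    (8, 𝒟.n + 1, fun x => ∑ y ∈ Finset.range x, 𝒟.w y * 𝒟.b y),
    (10, 𝒟.n + 1, fun x => radixIndex 𝒟.d x 𝒟.v), (13, (𝒟.n + 1) * 𝒟.L, 𝒟.table)]) (by simp)
  refine Runs.seq (runs_epsilonProg h hs (by simp) rfl rfl rfl rfl rfl) fun s hs => ?_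
  refine Runs.seq (runs_alphaProg h hs (by simp) rfl rfl rfl rfl) fun s hs => ?_
  refine Runs.seq (runs_betaProg h hs (by simp) rfl rfl rfl) fun s hs => ?_
  -- Register 0 is overwritten last, because all the preceding loops read n from it.
  refine (Runs.assign ⟨?_, hs.neg, fun i hi => ?_, fun i hi => ?_, fun j hj => ?_⟩).mono
    (by simp [Expr.cost, NExpr, σExpr]) fun _ h => h
  · rw [eval_NExpr h hs rfl rfl]
    simp [State.setReg]
  · exact hs.holds (0, 𝒟.N + 1, fun i =>
      ((boxPoly 𝒟.n 𝒟.σ 𝒟.d 𝒟.p 𝒟.w 𝒟.n 𝒟.v).coeff i : ℤ)) (by simp) i (Nat.lt_succ_of_le hi)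
  · exact hs.holds (1, 𝒟.N + 1, fun i =>
      (∑ y ∈ Finset.range 𝒟.n, 𝒟.w y * 𝒟.b y - i) / 𝒟.Δ) (by simp) i (Nat.lt_succ_of_le hi)
  · exact hs.holds (2, 𝒟.n, fun j => -(𝒟.σ * 𝒟.w j : ℤ) / 𝒟.Δ) (by simp) j hj

end Data

/-! ### The whole program -/

section Main

open Matrix

theorem encodeVector_apply {n : ℕ} (v : Fin n → ℤ) (i : Fin n) : encodeVector v (i : ℕ) = v i := by
  rw [encodeVector, Finset.sum_eq_single i]
  · simp
  · intro j _ hj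
    rw [if_neg]
    exact fun h => hj (Fin.ext (by exact_mod_cast h.symm))
  · simp

theorem encodeMatrix_eq_zero {n : ℕ} (A : Matrix (Fin n) (Fin n) ℤ) {k : ℤ}
    (hk : ¬(0 ≤ k ∧ k < (n * n : ℕ))) : encodeMatrix A k = 0 := by
  refine Finset.sum_eq_zero fun i _ => Finset.sum_eq_zero fun j _ => if_neg ?_
  rintro rfl
  refine hk ⟨by positivity, ?_⟩
  exact_mod_cast add_mul_lt_mul i.2 j.2

theorem encodeMatrix_apply {n : ℕ} (A : Matrix (Fin n) (Fin n) ℤ) (i j : Fin n) :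
    encodeMatrix A ((i : ℤ) * n + j) = A i j := by
  have hinj : ∀ i' j' : Fin n, (i : ℤ) * n + j = (i' : ℤ) * n + j' → i' = i ∧ j' = j := by
    intro i' j' h
    have h' : n * (i : ℕ) + j = n * (i' : ℕ) + j' := by
      rw [mul_comm n, mul_comm n]; exact_mod_cast h
    have h₁ := congrArg (· / n) h'
    have h₂ := congrArg (· % n) h'
    simp only [Nat.mul_add_div (Fin.pos i), Nat.div_eq_of_lt, Nat.mul_add_mod, Nat.mod_eq_of_lt,
      Fin.is_lt, add_zero] at h₁ h₂
    exact ⟨Fin.ext h₁.symm, Fin.ext h₂.symm⟩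
  rw [encodeMatrix, Finset.sum_eq_single i, Finset.sum_eq_single j]
  · simp
  · exact fun j' _ hj' => if_neg fun h => hj' (hinj _ _ h).2
  · simp
  · exact fun i' _ hi' => Finset.sum_eq_zero fun j' _ => if_neg fun h => hi' (hinj _ _ h).1
  · simp

/-- The program computing a representation, from a program computing the Smith normal form. -/
def coneProg {ι : Type} (M : Prog ι) : Prog ι :=
  .seq (fill 20 (Expr.reg 0 * Expr.reg 0) (Expr.arr 0 (Expr.reg 1)))
    (.seq (.assign 20 (Expr.reg 0)) (.seq (M.shift 20) Data.conePart))

/-- After A and n are copied to array and register 20, the memory from 20 on is exactly the input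
that `M` expects. Below 20 the shifted run leaves n, A, b and c intact. -/
theorem runs_coneProg {ι : Type} {F : ι → ℤ → ℤ → ℤ → ℤ} {M : Prog ι}
    {n t T : ℕ} {A : Matrix (Fin n) (Fin n) ℤ} {b c : Fin n → ℤ} {s₁ : State}
    {post : State → Prop} (hM : Exec F M (matrixInput A) t s₁)
    (hpost : ∀ s : State, s₁.Embeds 20 s → s.reg 0 = n → s.arr 0 = encodeMatrix A →
      s.arr 1 = encodeVector b → s.arr 2 = encodeVector c → Runs F Data.conePart s T post) :
    Runs F (coneProg M) (systemInput A b c) ((n * n + 1) * 40 + (2 + (t + T))) post := by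
  refine Runs.seq ((runs_fill (len := n * n) (f := fun k => encodeMatrix A k)
    (fun s' hs' _ => ?_) (fun s' x hx hs' _ hr hk => ?_)).mono ?_ fun _ h => h)
    fun s ⟨hs, hs20⟩ => ?_
  · simp [hs'.reg 0 (by decide), systemInput]
  · simp [Expr.eval, hr, hs'.arr 0 (by decide), systemInput]
  · simp [Expr.cost]
  refine Runs.seq (Runs.assign rfl) fun s' hs' => ?_
  have hemb : (matrixInput A).Embeds 20 s' := by
    subst hs'
    refine ⟨fun x => ?_, fun a => ?_⟩
    · by_cases hx : x = 0
      · subst hx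
        simp [State.setReg, matrixInput, hs.reg 0 (by decide), systemInput]
      · simp [State.setReg, matrixInput, hx, hs.reg (x + 20) (by omega), systemInput]
    · by_cases ha : a = 0
      · subst ha
        funext k
        simp only [State.setReg, matrixInput, if_true, zero_add]
        rw [hs20]
        split_ifs with hk
        · simp [Int.toNat_of_nonneg hk.1]
        · rw [encodeMatrix_eq_zero A hk]
          simp [systemInput]
      · simp [State.setReg, matrixInput, ha, hs.arr (a + 20) (by omega), systemInput]
  obtain ⟨s₂, hex, hemb₂, hbelow⟩ := hM.shift s' hemb
  refine Runs.seq ⟨t, s₂, hex, le_rfl, rfl⟩ ?_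
  rintro _ rfl
  subst hs'
  refine hpost _ hemb₂ ?_ ?_ ?_ ?_
  · rw [hbelow.reg 0 (by decide)]
    simp [State.setReg, hs.reg 0 (by decide), systemInput]
  · rw [hbelow.arr 0 (by decide)]
    simp [State.setReg, hs.arr 0 (by decide), systemInput]
  · rw [hbelow.arr 1 (by decide)]
    simp [State.setReg, hs.arr 1 (by decide), systemInput]
  · rw [hbelow.arr 2 (by decide)]
    simp [State.setReg, hs.arr 2 (by decide), systemInput]

/-- The data read from the memory. -/
def memoryData (n σ : ℕ) (A : Matrix (Fin n) (Fin n) ℤ) (b c : Fin n → ℤ) (s : State) : Data where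
  n := n
  σ := σ
  Δ := A.det.natAbs
  S := fun k => s.arr 20 k
  P := fun k => s.arr 21 k
  Q := fun k => s.arr 22 k
  b := fun k => encodeVector b k
  c := fun k => encodeVector c k
  w := fun k => if h : k < n then (c ⬝ᵥ (starMatrix A).col ⟨k, h⟩).toNat else 0

variable {n σ : ℕ} {A S P Q : Matrix (Fin n) (Fin n) ℤ} {b c : Fin n → ℤ} {s : State}

theorem isConeData_memoryData (hn : 0 < n) (hA : A.det ≠ 0)
    (hc : ∀ i, 0 < c ⬝ᵥ (starMatrix A).col i) (h : IsSNF A S P Q)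
    (hσ : S ⟨n - 1, Nat.sub_lt hn one_pos⟩ ⟨n - 1, Nat.sub_lt hn one_pos⟩ = (σ : ℤ))
    (hS : s.HoldsMatrix 20 S) (hP : s.HoldsMatrix 21 P) :
    IsConeData A S P Q b c σ (memoryData n σ A b c s).d (memoryData n σ A b c s).p
      (memoryData n σ A b c s).w (memoryData n σ A b c s).v where
  pos := hn
  det_ne := hA
  weight_pos := hc
  snf := h
  last := hσ
  d_eq j := by rw [← hS j j]; simp [Data.d, memoryData]
  p_eq j k := by rw [← hP j k]; simp [Data.p, memoryData]
  w_eq k := by simp [memoryData, (hc k).le]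
  v_eq j := by
    simp only [Data.v, Data.p, memoryData, mulVec, dotProduct, Finset.sum_range]
    refine Finset.sum_congr rfl fun k _ => ?_
    rw [encodeVector_apply, ← hP j k]
    simp

/-- The weights in `memoryData` are defined through A^*; `IsSNF.starMatrix_eq` matches them with the
formula c Q (ΔS⁻¹) P, and `IsSNF.prod_diag` gives Δ as the last place value. -/
theorem valid_memoryData (hn : 0 < n) (hA : A.det ≠ 0)
    (hc : ∀ i, 0 < c ⬝ᵥ (starMatrix A).col i) (h : IsSNF A S P Q)
    (hσ : S ⟨n - 1, Nat.sub_lt hn one_pos⟩ ⟨n - 1, Nat.sub_lt hn one_pos⟩ = (σ : ℤ))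
    (hS : s.HoldsMatrix 20 S) (hP : s.HoldsMatrix 21 P) (hQ : s.HoldsMatrix 22 Q) :
    (memoryData n σ A b c s).Valid := by
  have hcd := isConeData_memoryData (b := b) hn hA hc h hσ hS hP
  refine ⟨hn, hcd.sigma_pos, fun j => hcd.d_pos, fun j => hcd.d_dvd, ?_, ?_,
    fun k => hcd.w_pos, fun k hk => ?_⟩
  · change place _ n = (A.det.natAbs : ℤ)
    rw [← h.prod_diag, place, Finset.prod_range]
    exact Finset.prod_congr rfl fun j _ => hcd.d_eq j
  · change s.arr 20 ((n * n - 1 : ℕ) : ℤ) = (σ : ℤ)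
    rw [← hσ, ← hS]
    congr 1
    have h₁ : 1 ≤ n * n := Nat.mul_pos hn hn
    push_cast [Nat.cast_sub h₁, Nat.cast_sub (show 1 ≤ n from hn)]
    ring
  · rw [hcd.w_eq ⟨k, hk⟩, h.starMatrix_eq hA]
    change (c ᵥ* (Q * diagonal _ * P)) ⟨k, hk⟩ = _
    rw [← vecMul_vecMul, ← vecMul_vecMul, vecMul, dotProduct, Finset.sum_range]
    refine Finset.sum_congr rfl fun j _ => ?_
    rw [vecMul_diagonal, hcd.d_eq j, hcd.p_eq j ⟨k, hk⟩]
    congr 2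
    simp only [Data.u, memoryData, vecMul, dotProduct, Finset.sum_range]
    refine Finset.sum_congr rfl fun i _ => ?_
    rw [encodeVector_apply, ← hQ i j]
    simp

theorem maxWeight_memoryData (hc : ∀ i, 0 < c ⬝ᵥ (starMatrix A).col i) :
    (memoryData n σ A b c s).maxWeight n = chi A c := by
  have hw : ∀ k : Fin n, (memoryData n σ A b c s).w k = (c ⬝ᵥ (starMatrix A).col k).natAbs :=
    fun k => by
      have := hc k
      simp only [memoryData, Fin.is_lt, dite_true, Fin.eta]
      omega
  refine le_antisymm (Finset.sup_le fun k hk => ?_) (Finset.sup_le fun k _ => ?_)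
  · rw [hw ⟨k, Finset.mem_range.1 hk⟩]
    exact Finset.le_sup (f := fun i => (c ⬝ᵥ (starMatrix A).col i).natAbs) (Finset.mem_univ _)
  · rw [← hw]
    exact Finset.le_sup (Finset.mem_range.2 k.2)

end Main

end ConeSeries

theorem lemma1 :
    (∀ (n : ℕ) (hn : 0 < n) (A S P Q : Matrix (Fin n) (Fin n) ℤ) (b c : Fin n → ℤ) (σ : ℕ),
      A.det ≠ 0 →
      (∀ i, 0 < c ⬝ᵥ (ConeSeries.starMatrix A).col i) →
      ConeSeries.IsSNF A S P Q →
      S ⟨n - 1, Nat.sub_lt hn one_pos⟩ ⟨n - 1, Nat.sub_lt hn one_pos⟩ = (σ : ℤ) →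
      ∃ (ε : ℤ → ℕ) (α : ℤ → ℤ) (β : Fin n → ℤ),
        ConeSeries.IsRepresentation A b c (n * σ * ConeSeries.chi A c) ε α β) ∧
    (∃ K : ℕ, ∀ (ι : Type) (F : ι → ℤ → ℤ → ℤ → ℤ) (M : ConeSeries.Prog ι)
        (T : (n : ℕ) → Matrix (Fin n) (Fin n) ℤ → ℕ),
      ConeSeries.ComputesSNF F M T →
      ∃ p : ConeSeries.Prog ι,
        ∀ (n : ℕ) (hn : 0 < n) (A S P Q : Matrix (Fin n) (Fin n) ℤ) (b c : Fin n → ℤ) (σ : ℕ),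
          A.det ≠ 0 →
          (∀ i, 0 < c ⬝ᵥ (ConeSeries.starMatrix A).col i) →
          ConeSeries.IsSNF A S P Q →
          S ⟨n - 1, Nat.sub_lt hn one_pos⟩ ⟨n - 1, Nat.sub_lt hn one_pos⟩ = (σ : ℤ) →
          ∃ (t : ℕ) (s : ConeSeries.State) (ε : ℤ → ℕ) (α : ℤ → ℤ) (β : Fin n → ℤ),
            ConeSeries.Exec F p (ConeSeries.systemInput A b c) t s ∧
            t ≤ K * (T n A + A.det.natAbs * n ^ 2 * σ * ConeSeries.chi A c) ∧
            ConeSeries.IsRepresentation A b c (n * σ * ConeSeries.chi A c) ε α β ∧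
            s.HoldsRepresentation (n * σ * ConeSeries.chi A c) ε α β) := by
  refine ⟨fun n hn A S P Q b c σ hA hc h hσ => ?_, 100000, fun ι F M T hM =>
    ⟨ConeSeries.coneProg M, fun n hn A S P Q b c σ hA hc h hσ => ?_⟩⟩
  -- A fictitious memory holding S and P, from which natural-number-indexed data are obtained as in
  -- the second part.
  · let s : ConeSeries.State := ⟨0, fun a =>
      if a = 20 then ConeSeries.encodeMatrix S else ConeSeries.encodeMatrix P⟩
    have hcd := ConeSeries.isConeData_memoryData (b := b) (s := s) hn hA hc h hσ
      (fun i j => by simp [s, ConeSeries.encodeMatrix_apply])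
      (fun i j => by simp [s, ConeSeries.encodeMatrix_apply])
    exact hcd.exists_isRepresentation
  · obtain ⟨t, s₁, S', P', Q', hex, ht, h', hS, hP, hQ⟩ := hM n A hn hA
    -- From here on σ is read off the Smith normal form that the program found.
    rw [h.last_unique h' hn] at hσ
    have hrun := ConeSeries.runs_coneProg (b := b) (c := c) hex
      (T := 80000 * (A.det.natAbs * n ^ 2 * σ * ConeSeries.chi A c))
      (post := fun s => ∃ ε α β,
        ConeSeries.IsRepresentation A b c (n * σ * ConeSeries.chi A c) ε α β ∧
          s.HoldsRepresentation (n * σ * ConeSeries.chi A c) ε α β) ?_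
    · obtain ⟨t', s', hex', ht', ε, α, β, hrep, hholds⟩ := hrun
      refine ⟨t', s', ε, α, β, hex', ht'.trans ?_, hrep, hholds⟩
      have hχ : 0 < ConeSeries.chi A c := ConeSeries.chi_pos hn hc
      have hσ' : 0 < σ := by
        have := h'.diag_pos hA ⟨n - 1, Nat.sub_lt hn one_pos⟩
        rw [hσ] at this
        exact_mod_cast this
      -- Copying the input costs O(n²), which is absorbed because Δσχ ≥ 1.
      have h₁ : n * n * 1 ≤ n * n * (A.det.natAbs * σ * ConeSeries.chi A c) :=
        Nat.mul_le_mul_left _ (Nat.mul_pos (Nat.mul_pos (Int.natAbs_pos.2 hA) hσ') hχ)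
      have h₂ : n * n * (A.det.natAbs * σ * ConeSeries.chi A c) =
        A.det.natAbs * n ^ 2 * σ * ConeSeries.chi A c := by ring
      have h₃ : 0 < n * n := Nat.mul_pos hn hn
      omega
    · intro s hemb hn0 h0 h1 h2
      have hS' : s.HoldsMatrix 20 S' := fun i j => (congrFun (hemb.arr 0) _).trans (hS i j)
      have hP' : s.HoldsMatrix 21 P' := fun i j => (congrFun (hemb.arr 1) _).trans (hP i j)
      have hQ' : s.HoldsMatrix 22 Q' := fun i j => (congrFun (hemb.arr 2) _).trans (hQ i j)
      have hcd := ConeSeries.isConeData_memoryData (b := b) (s := s) hn hA hc h' hσ hS' hP'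
      have hval := ConeSeries.valid_memoryData (b := b) hn hA hc h' hσ hS' hP' hQ'
      have hmax := ConeSeries.maxWeight_memoryData (σ := σ) (b := b) (s := s) hc
      have hneg : ∀ k : ℤ, k < 0 → s.arr 0 k = 0 := fun k hk => by
        rw [h0, ConeSeries.encodeMatrix_eq_zero A (by omega)]
      have hrun := ConeSeries.Data.runs_conePart (F := F) (s := s) hval
        ⟨hn0, hneg, by simp [ConeSeries.memoryData, h1, h2]⟩
      have hN : (ConeSeries.memoryData n σ A b c s).N = n * σ * ConeSeries.chi A c := by
        rw [← hmax]; rfl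
      rw [show (ConeSeries.memoryData n σ A b c s).maxWeight
        (ConeSeries.memoryData n σ A b c s).n = ConeSeries.chi A c from hmax, hN] at hrun
      refine hrun.mono le_rfl fun s' hs' => ?_
      obtain ⟨hr, hneg', hε, hα, hβ⟩ := hs'
      -- The representation is read off the final memory. At negative positions array 0 is still 0,
      -- so the contents of array 1 there are irrelevant.
      refine ⟨fun i => (s'.arr 0 i).toNat, s'.arr 1, fun j => s'.arr 2 (j : ℕ),
        hcd.isRepresentation (fun i hi => ?_) (fun i hi => ?_) (fun i hi => ?_) fun j => ?_,
        hr, fun i hi => ⟨?_, rfl⟩, fun j => rfl⟩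
      · simp [hneg' i hi]
      · simp only [hε i hi, Int.toNat_natCast]; rfl
      · rw [hα i hi]
        simp only [Finset.sum_range]
        congr 2
        exact Finset.sum_congr rfl fun k _ =>
          congrArg _ (ConeSeries.encodeVector_apply b k)
      · exact hβ j j.2
      · rcases lt_or_ge i 0 with hi0 | hi0
        · simp [hneg' i hi0]
        · obtain ⟨k, rfl⟩ := Int.eq_ofNat_of_zero_le hi0
          have := (Finset.mem_Icc.1 hi).2
          have hk := hε k (by exact_mod_cast this)
          exact (Int.toNat_of_nonneg (hk ▸ Int.natCast_nonneg _)).symm
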